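/- Let $H=L^2(\mathbb{R}_+)$ (complex-valued functions on $\mathbb{R}_+=[0,\infty)$ with Lebesgue measure), identify $H^{\otimes n}$ with $L^2(\mathbb{R}_+^n)$, and let $\mathcal{F}_0(H)=\mathbb{C}\Omega\oplus\bigoplus_{n\ge1}H^{\otimes n}$ be the full Fock space with vacuum vector $\Omega$. For $h\in H$ let $c_0(h)$ be the left creation operator, $c_0(h)(f_1\otimes\cdots\otimes f_n)=h\otimes f_1\otimes\cdots\otimes f_n$, let $\omega_0(h)=c_0(h)+c_0(h)^*$, let $\Gamma_0=\{\omega_0(h): h\in H \text{ real-valued}\}''$ be the generated von Neumann algebra, and let $\tau_0(A)=\langle A\Omega,\Omega\rangle$. For $f\in H^{\otimes n}$ the free Wigner integral $I_0(f)$ is the element of $\Gamma_0$ determined by $I_0(f)\Omega=f$. The fourth free cumulant of $A$ with respect to $\tau_0$ is $$\kappa_4(A)=\tau_0(A^4)-4\tau_0(A)\tau_0(A^3)-2\tau_0(A^2)^2+10\,\tau_0(A)^2\tau_0(A^2)-5\,\tau_0(A)^4,$$ which equals $\tau_0(A^4)-2\tau_0(A^2)^2$ when $\tau_0(A)=0$,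 and $\mathrm{cov}(A,B)=\tau_0(AB)-\tau_0(A)\tau_0(B)$. For $f\in L^2(\mathbb{R}_+^m)$ put $f^*(t_1,\dots,t_m)=\overline{f(t_m,\dots,t_1)}$, and for $g\in L^2(\mathbb{R}_+^n)$ and $0\le p\le m\wedge n$ (where $m\wedge n=\min(m,n)$) define the contraction $f\overset{p}{\frown}g\in L^2(\mathbb{R}_+^{m+n-2p})$ by $$(f\overset{p}{\frown}g)(t_1,\dots,t_{m-p},r_1,\dots,r_{n-p})=\int_{\mathbb{R}_+^p}f(t_1,\dots,t_{m-p},s_1,\dots,s_p)\,g(s_p,\dots,s_1,r_1,\dots,r_{n-p})\,ds_1\cdots ds_p .$$ Let $m,n\ge1$ be integers of opposite parity, and let $f=f^*\in H^{\otimes m}$ and $g=g^*\in H^{\otimes n}$. Then there is exactly one $X\in\Gamma_0$ with $X\Omega=f$ and exactly one $Y\in\Gamma_0$ with $Y\Omega=g$, that is, $X=I_0(f)$ and $Y=I_0(g)$ are well defined, and $$\kappa_4(X+Y)=\kappa_4(X)+\kappa_4(Y)+4\,\mathrm{cov}(X^2,Y^2)+2\,\tau_0(XYXY).$$ Moreover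 $\kappa_4(X)$, $\kappa_4(Y)$ and $4\,\mathrm{cov}(X^2,Y^2)+2\,\tau_0(XYXY)$ are real and nonnegative, and $$\kappa_4(X)=\sum_{p=1}^{m-1}\bigl\|f\overset{p}{\frown}f\bigr\|^2,\qquad \kappa_4(Y)=\sum_{p=1}^{n-1}\bigl\|g\overset{p}{\frown}g\bigr\|^2,$$ $$4\,\mathrm{cov}(X^2,Y^2)+2\,\tau_0(XYXY)=2\sum_{p=1}^{m\wedge n-1}\bigl\|f\overset{p}{\frown}g\bigr\|^2+\sum_{p=1}^{m\wedge n}\bigl\|f\overset{p}{\frown}g+g\overset{p}{\frown}f\bigr\|^2+\bigl\|f\overset{m\wedge n}{\frown}g+g\overset{m\wedge n}{\frown}f\bigr\|^2 .$$ -/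

import Mathlib

open MeasureTheory Set
open scoped ENNReal ComplexOrder

noncomputable section

namespace FreeWigner

/-- Lebesgue measure on the half line `ℝ₊ = [0, ∞)`, as a measure on `ℝ` carried by `[0, ∞)`. -/
abbrev halfLine : Measure ℝ := volume.restrict (Ici 0)

/-- Lebesgue measure on `ℝ₊ⁿ`. -/
abbrev cube (n : ℕ) : Measure (Fin n → ℝ) := Measure.pi fun _ => halfLine

/-- The Hilbert space `H = L²(ℝ₊)` of complex-valued square integrable functions. -/
abbrev H : Type := Lp ℂ 2 halfLine

/-- The `n`-particle space `H^{⊗ n} = L²(ℝ₊ⁿ)` (for `n = 0` a one-dimensional space). -/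
abbrev Particle (n : ℕ) : Type := Lp ℂ 2 (cube n)

/-- The full Fock space `ℂ Ω ⊕ ⨁_{n ≥ 1} H^{⊗ n}` (Hilbert space direct sum). -/
abbrev Fock : Type := lp (fun n : ℕ => Particle n) 2

/-- The inclusion of the `n`-particle space in the full Fock space. -/
def incl {n : ℕ} (f : Particle n) : Fock := lp.single 2 n f

theorem memLp_one : MemLp (fun _ : Fin 0 → ℝ => (1 : ℂ)) 2 (cube 0) := by
  rw [cube, Measure.pi_of_empty]
  exact memLp_const 1

/-- The vacuum vector: the constant function `1` in the `0`-particle space. -/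
def vacuum : Fock := incl memLp_one.toLp

theorem eLpNorm_mul_prod {α β : Type*} [MeasurableSpace α] [MeasurableSpace β] {μ : Measure α}
    {ν : Measure β} [SFinite ν] {f : α → ℂ} {g : β → ℂ}
    (hf : AEStronglyMeasurable f μ) (hg : AEStronglyMeasurable g ν) :
    eLpNorm (fun z : α × β => f z.1 * g z.2) 2 (μ.prod ν) = eLpNorm f 2 μ * eLpNorm g 2 ν := by
  simp only [eLpNorm_eq_lintegral_rpow_enorm_toReal (p := 2) (by norm_num) (by norm_num)]
  rw [← ENNReal.mul_rpow_of_nonneg _ _ (by norm_num),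
    ← lintegral_prod_mul (hf.enorm.pow_const _) (hg.enorm.pow_const _)]
  congr 2
  ext z
  rw [enorm_mul, ENNReal.mul_rpow_of_nonneg _ _ (by norm_num)]

theorem measurePreserving_cons (n : ℕ) :
    MeasurePreserving (fun u : Fin (n + 1) → ℝ => (u 0, fun i : Fin n => u i.succ))
      (cube (n + 1)) (halfLine.prod (cube n)) :=
  measurePreserving_piFinSuccAbove (fun _ : Fin (n + 1) => halfLine) 0

/-- The function `(h ⊗ φ)(t₀, t₁, …, tₙ) = h(t₀) φ(t₁, …, tₙ)`. -/
def tensorFun {n : ℕ} (h : H) (φ : Particle n) (u : Fin (n + 1) → ℝ) : ℂ :=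
  h (u 0) * φ fun i : Fin n => u i.succ

theorem aestronglyMeasurable_tensorFun {n : ℕ} (h : H) (φ : Particle n) :
    AEStronglyMeasurable (tensorFun h φ) (cube (n + 1)) := by
  have hm : AEStronglyMeasurable (fun z : ℝ × (Fin n → ℝ) => h z.1 * φ z.2)
      (halfLine.prod (cube n)) :=
    (Lp.aestronglyMeasurable h).comp_fst.mul (Lp.aestronglyMeasurable φ).comp_snd
  exact hm.comp_measurePreserving (measurePreserving_cons n)

theorem eLpNorm_tensorFun {n : ℕ} (h : H) (φ : Particle n) :
    eLpNorm (tensorFun h φ) 2 (cube (n + 1)) =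
      eLpNorm h 2 halfLine * eLpNorm φ 2 (cube n) := by
  have hm : AEStronglyMeasurable (fun z : ℝ × (Fin n → ℝ) => h z.1 * φ z.2)
      (halfLine.prod (cube n)) :=
    (Lp.aestronglyMeasurable h).comp_fst.mul (Lp.aestronglyMeasurable φ).comp_snd
  have h1 := eLpNorm_comp_measurePreserving (p := 2) hm (measurePreserving_cons n)
  rw [eLpNorm_mul_prod (Lp.aestronglyMeasurable h) (Lp.aestronglyMeasurable φ)] at h1
  rw [← h1]
  rfl

theorem memLp_tensorFun {n : ℕ} (h : H) (φ : Particle n) :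
    MemLp (tensorFun h φ) 2 (cube (n + 1)) := by
  refine ⟨aestronglyMeasurable_tensorFun h φ, ?_⟩
  rw [eLpNorm_tensorFun h φ]
  exact ENNReal.mul_lt_top (Lp.eLpNorm_lt_top h) (Lp.eLpNorm_lt_top φ)

/-- The tensor `h ⊗ φ ∈ H^{⊗ (n+1)}` of `h ∈ H` and `φ ∈ H^{⊗ n}`. -/
def tensor {n : ℕ} (h : H) (φ : Particle n) : Particle (n + 1) := (memLp_tensorFun h φ).toLp

theorem norm_tensor {n : ℕ} (h : H) (φ : Particle n) : ‖tensor h φ‖ = ‖h‖ * ‖φ‖ := by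
  rw [tensor, Lp.norm_toLp, eLpNorm_tensorFun h φ, ENNReal.toReal_mul, ← Lp.norm_def,
    ← Lp.norm_def]

theorem ae_cons {n : ℕ} {p : (Fin n → ℝ) → Prop} (hp : ∀ᵐ x ∂cube n, p x) :
    ∀ᵐ u ∂cube (n + 1), p fun i : Fin n => u i.succ :=
  (Measure.quasiMeasurePreserving_snd.comp
    (measurePreserving_cons n).quasiMeasurePreserving).ae hp

theorem tensor_add {n : ℕ} (h : H) (φ ψ : Particle n) :
    tensor h (φ + ψ) = tensor h φ + tensor h ψ := by
  rw [tensor, tensor, tensor, ← MemLp.toLp_add]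
  refine MemLp.toLp_congr _ _ ?_
  filter_upwards [ae_cons (Lp.coeFn_add φ ψ)] with u hu
  simp only [tensorFun, hu, Pi.add_apply, mul_add]

theorem tensor_smul {n : ℕ} (h : H) (c : ℂ) (φ : Particle n) :
    tensor h (c • φ) = c • tensor h φ := by
  rw [tensor, tensor, ← MemLp.toLp_const_smul]
  refine MemLp.toLp_congr _ _ ?_
  filter_upwards [ae_cons (Lp.coeFn_smul c φ)] with u hu
  simp [tensorFun, hu, mul_left_comm]

/-- The components of `c₀(h) F`: zero in degree `0`, and `h ⊗ Fₙ` in degree `n + 1`. -/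
def creationSeq (h : H) (F : ∀ n, Particle n) : ∀ n, Particle n
  | 0 => 0
  | n + 1 => tensor h (F n)

theorem hasSum_creationSeq (h : H) (F : Fock) :
    HasSum (fun n => ‖creationSeq h F n‖ ^ (2 : ℝ)) ((‖h‖ * ‖F‖) ^ (2 : ℝ)) := by
  have h2 : (0 : ℝ) < (2 : ℝ≥0∞).toReal := by norm_num
  have hF : HasSum (fun n => ‖F n‖ ^ (2 : ℝ)) (‖F‖ ^ (2 : ℝ)) := by
    simpa using lp.hasSum_norm h2 F
  rw [← hasSum_nat_add_iff' 1]
  have := hF.mul_left (‖h‖ ^ (2 : ℝ))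
  simpa [creationSeq, norm_tensor, mul_pow] using this

theorem memℓp_creationSeq (h : H) (F : Fock) : Memℓp (creationSeq h F) 2 :=
  memℓp_gen (by simpa using (hasSum_creationSeq h F).summable)

/-- The left creation operator `c₀(h) : f₁ ⊗ ⋯ ⊗ fₙ ↦ h ⊗ f₁ ⊗ ⋯ ⊗ fₙ` on the full Fock space. -/
def creation (h : H) : Fock →L[ℂ] Fock :=
  LinearMap.mkContinuous
    { toFun := fun F => ⟨creationSeq h F, memℓp_creationSeq h F⟩
      map_add' := fun F G => by
        ext1
        funext n
        cases n with
        | zero => exact (add_zero _).symm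
        | succ n => exact tensor_add h (F n) (G n)
      map_smul' := fun c F => by
        ext1
        funext n
        cases n with
        | zero => exact (smul_zero c).symm
        | succ n => exact tensor_smul h c (F n) }
    ‖h‖ (fun F => by
      have h2 : (0 : ℝ) < (2 : ℝ≥0∞).toReal := by norm_num
      have h1 := lp.hasSum_norm h2 (⟨creationSeq h F, memℓp_creationSeq h F⟩ : Fock)
      have h3 := hasSum_creationSeq h F
      simp only [ENNReal.toReal_ofNat] at h1
      have h4 := h1.unique h3
      exact ((Real.rpow_left_inj (norm_nonneg _) (by positivity) (by norm_num)).1 h4).le)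

/-- The semicircular field operator `ω₀(h) = c₀(h) + c₀(h)*`. -/
def field (h : H) : Fock →L[ℂ] Fock := creation h + ContinuousLinearMap.adjoint (creation h)

/-- The real Hilbert space of (almost everywhere) real-valued functions in `L²(ℝ₊)`. -/
def realH : Set H := {h | ∀ᵐ t ∂halfLine, (h t).im = 0}

/-- The von Neumann algebra `Γ₀ = {ω₀(h) : h real}''` (bicommutant). -/
def vonNeumann : Set (Fock →L[ℂ] Fock) := centralizer (centralizer (field '' realH))

/-- The vacuum state `τ₀(A) = ⟨A Ω, Ω⟩` (Mathlib's inner product is linear in its second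
argument). -/
def trace (A : Fock →L[ℂ] Fock) : ℂ := inner ℂ vacuum (A vacuum)

/-- `X` is the free Wigner integral of `f`: it lies in `Γ₀` and `X Ω = f`. -/
def IsWignerIntegral {n : ℕ} (f : Particle n) (X : Fock →L[ℂ] Fock) : Prop :=
  X ∈ vonNeumann ∧ X vacuum = incl f

open Classical in
/-- The free Wigner integral `I₀(f)`: the element of `Γ₀` with `I₀(f) Ω = f`. -/
def wignerIntegral {n : ℕ} (f : Particle n) : Fock →L[ℂ] Fock :=
  if h : ∃ X, IsWignerIntegral f X then h.choose else 0

/-- The fourth free cumulant, in terms of the moments of `A` under `τ₀`. -/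
def kappa4 (A : Fock →L[ℂ] Fock) : ℂ :=
  trace (A ^ 4) - 4 * trace A * trace (A ^ 3) - 2 * trace (A ^ 2) ^ 2
    + 10 * trace A ^ 2 * trace (A ^ 2) - 5 * trace A ^ 4

/-- For a centered variable the fourth free cumulant is `τ₀(A⁴) - 2 τ₀(A²)²`. -/
theorem kappa4_of_centered {A : Fock →L[ℂ] Fock} (hA : trace A = 0) :
    kappa4 A = trace (A ^ 4) - 2 * trace (A ^ 2) ^ 2 := by
  simp [kappa4, hA]

/-- The covariance of two (self-adjoint) variables under `τ₀`. -/
def cov (A B : Fock →L[ℂ] Fock) : ℂ := trace (A * B) - trace A * trace B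

theorem measurePreserving_rev (n : ℕ) :
    MeasurePreserving (fun (u : Fin n → ℝ) (i : Fin n) => u i.rev) (cube n) (cube n) := by
  have := measurePreserving_piCongrLeft (fun _ : Fin n => halfLine) Fin.revPerm
  convert this using 1
  ext u i
  obtain ⟨j, rfl⟩ := Fin.revPerm.surjective i
  rw [MeasurableEquiv.coe_piCongrLeft, Equiv.piCongrLeft_apply_apply]
  simp

/-- The adjoint kernel `f*(t₁, …, tₙ) = conj f(tₙ, …, t₁)`. -/
def adj {n : ℕ} (f : Particle n) : Particle n :=
  star (Lp.compMeasurePreserving _ (measurePreserving_rev n) f)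

theorem measurePreserving_split (a b : ℕ) :
    MeasurePreserving (fun u : Fin (a + b) → ℝ =>
      (fun i : Fin a => u (Fin.castAdd b i), fun i : Fin b => u (Fin.natAdd a i)))
      (cube (a + b)) ((cube a).prod (cube b)) :=
  (measurePreserving_sumPiEquivProdPi (X := fun _ : Fin a ⊕ Fin b => ℝ) fun _ => halfLine).comp
    (measurePreserving_piCongrLeft (fun _ : Fin (a + b) => halfLine) finSumFinEquiv).symm

theorem measurePreserving_append (a b : ℕ) :
    MeasurePreserving (fun z : (Fin a → ℝ) × (Fin b → ℝ) => Fin.append z.1 z.2)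
      ((cube a).prod (cube b)) (cube (a + b)) := by
  have h1 := measurePreserving_sumPiEquivProdPi_symm
    (X := fun _ : Fin a ⊕ Fin b => ℝ) (fun _ => halfLine)
  have h2 := measurePreserving_piCongrLeft (fun _ : Fin (a + b) => halfLine) finSumFinEquiv
  convert h2.comp h1 using 1
  funext z i
  refine Fin.addCases (fun i => ?_) (fun i => ?_) i <;>
    simp [MeasurableEquiv.piCongrLeft, Equiv.piCongrLeft, Equiv.piCongrLeft',
      MeasurableEquiv.sumPiEquivProdPi, Equiv.sumPiEquivProdPi]

theorem eLpNorm_two_lt_top {α : Type*} [MeasurableSpace α] {μ : Measure α} {f : α → ℂ} :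
    eLpNorm f 2 μ < ∞ ↔ ∫⁻ x, ‖f x‖ₑ ^ (2 : ℝ) ∂μ < ∞ := by
  simpa using eLpNorm_lt_top_iff_lintegral_rpow_enorm_lt_top (f := f) (μ := μ) (p := 2)
    (by norm_num) (by norm_num)

/-- Square integrability of the composition of two square integrable kernels. -/
theorem memLp_kernel_comp {α β κ : Type*} [MeasurableSpace α] [MeasurableSpace β]
    [MeasurableSpace κ] {μ : Measure α} {ν : Measure β} {ρ : Measure κ} [SFinite μ] [SFinite ν]
    [SFinite ρ] {F : α × κ → ℂ} {G : κ × β → ℂ} (hF : MemLp F 2 (μ.prod ρ))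
    (hG : MemLp G 2 (ρ.prod ν)) :
    MemLp (fun z : α × β => ∫ s, F (z.1, s) * G (s, z.2) ∂ρ) 2 (μ.prod ν) := by
  have hm : AEStronglyMeasurable (fun w : (α × β) × κ => F (w.1.1, w.2) * G (w.2, w.1.2))
      ((μ.prod ν).prod ρ) := by
    have q1 : Measure.QuasiMeasurePreserving (fun w : (α × β) × κ => (w.1.1, w.2))
        ((μ.prod ν).prod ρ) (μ.prod ρ) :=
      QuasiMeasurePreserving.prodMap Measure.quasiMeasurePreserving_fst (Measure.QuasiMeasurePreserving.id ρ)
    have q2 : Measure.QuasiMeasurePreserving (fun w : (α × β) × κ => (w.2, w.1.2))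
        ((μ.prod ν).prod ρ) (ρ.prod ν) :=
      Measure.measurePreserving_swap.quasiMeasurePreserving.comp
        (QuasiMeasurePreserving.prodMap Measure.quasiMeasurePreserving_snd
          (Measure.QuasiMeasurePreserving.id ρ))
    exact (hF.1.comp_quasiMeasurePreserving q1).mul (hG.1.comp_quasiMeasurePreserving q2)
  refine ⟨hm.integral_prod_right', ?_⟩
  have hF2 : ∫⁻ t, ∫⁻ s, ‖F (t, s)‖ₑ ^ (2 : ℝ) ∂ρ ∂μ < ∞ := by
    rw [← lintegral_prod _ (hF.1.enorm.pow_const _)]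
    exact eLpNorm_two_lt_top.1 hF.2
  have hG2 : ∫⁻ r, ∫⁻ s, ‖G (s, r)‖ₑ ^ (2 : ℝ) ∂ρ ∂ν < ∞ := by
    rw [← lintegral_prod_symm _ (hG.1.enorm.pow_const _)]
    exact eLpNorm_two_lt_top.1 hG.2
  rw [eLpNorm_two_lt_top]
  calc ∫⁻ z : α × β, ‖∫ s, F (z.1, s) * G (s, z.2) ∂ρ‖ₑ ^ (2 : ℝ) ∂μ.prod ν
      ≤ ∫⁻ z : α × β, (∫⁻ s, ‖F (z.1, s)‖ₑ ^ (2 : ℝ) ∂ρ) *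
          (∫⁻ s, ‖G (s, z.2)‖ₑ ^ (2 : ℝ) ∂ρ) ∂μ.prod ν := by
        refine lintegral_mono_ae ?_
        filter_upwards [Measure.quasiMeasurePreserving_fst.ae hF.1.prodMk_left,
          Measure.quasiMeasurePreserving_snd.ae hG.1.prod_swap.prodMk_left] with z h1 h2
        have h3 := ENNReal.lintegral_mul_le_Lp_mul_Lq ρ Real.HolderConjugate.two_two
          h1.enorm h2.enorm
        have h4 : ‖∫ s, F (z.1, s) * G (s, z.2) ∂ρ‖ₑ ≤
            (∫⁻ s, ‖F (z.1, s)‖ₑ ^ (2 : ℝ) ∂ρ) ^ (1 / 2 : ℝ) *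
              (∫⁻ s, ‖G (s, z.2)‖ₑ ^ (2 : ℝ) ∂ρ) ^ (1 / 2 : ℝ) := by
          refine (enorm_integral_le_lintegral_enorm _).trans ?_
          simp only [enorm_mul]
          exact h3
        refine (ENNReal.rpow_le_rpow h4 (by norm_num)).trans ?_
        rw [ENNReal.mul_rpow_of_nonneg _ _ (by norm_num), ← ENNReal.rpow_mul, ← ENNReal.rpow_mul]
        norm_num
    _ = (∫⁻ t, ∫⁻ s, ‖F (t, s)‖ₑ ^ (2 : ℝ) ∂ρ ∂μ) *
          ∫⁻ r, ∫⁻ s, ‖G (s, r)‖ₑ ^ (2 : ℝ) ∂ρ ∂ν :=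
        lintegral_prod_mul (hF.1.enorm.pow_const _).lintegral_prod_right'
          (hG.1.enorm.pow_const _).lintegral_prod_left'
    _ < ∞ := ENNReal.mul_lt_top hF2 hG2

/-- The function
`(f ⌢ᵏ g)(t₁, …, t_a, r₁, …, r_b) = ∫ f(t₁, …, t_a, s₁, …, sₖ) g(sₖ, …, s₁, r₁, …, r_b) ds`,
for `m = a + k` and `n = k + b`. -/
def contractFun {m n a b k : ℕ} (ha : m = a + k) (hb : n = k + b) (f : Particle m)
    (g : Particle n) (u : Fin (a + b) → ℝ) : ℂ :=
  ∫ s, f (Fin.append (fun i : Fin a => u (Fin.castAdd b i)) s ∘ Fin.cast ha) *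
    g (Fin.append (fun i : Fin k => s i.rev) (fun i : Fin b => u (Fin.natAdd a i)) ∘ Fin.cast hb)
    ∂cube k

theorem memLp_contractFun {m n a b k : ℕ} (ha : m = a + k) (hb : n = k + b) (f : Particle m)
    (g : Particle n) : MemLp (contractFun ha hb f g) 2 (cube (a + b)) := by
  subst ha hb
  have hF : MemLp (fun z : (Fin a → ℝ) × (Fin k → ℝ) => f (Fin.append z.1 z.2)) 2
      ((cube a).prod (cube k)) :=
    (Lp.memLp f).comp_measurePreserving (measurePreserving_append a k)
  have hG : MemLp (fun z : (Fin k → ℝ) × (Fin b → ℝ) =>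
      g (Fin.append (fun i : Fin k => z.1 i.rev) z.2)) 2 ((cube k).prod (cube b)) :=
    (Lp.memLp g).comp_measurePreserving ((measurePreserving_append k b).comp
      ((measurePreserving_rev k).prod (MeasurePreserving.id (cube b))))
  have h1 := (memLp_kernel_comp hF hG).comp_measurePreserving (measurePreserving_split a b)
  convert h1 using 1
  funext u
  simp only [contractFun, Fin.cast_refl, Function.comp_id, Function.comp_apply]

/-- The contraction `f ⌢ᵏ g ∈ H^{⊗ (m + n - 2k)}` of `f ∈ H^{⊗ m}` and `g ∈ H^{⊗ n}`, as an element
of the full Fock space, for `k ≤ min m n` (and `0` for the meaningless values of `k`). -/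
def contraction {m n : ℕ} (k : ℕ) (f : Particle m) (g : Particle n) : Fock :=
  if h : k ≤ m ∧ k ≤ n then
    incl (memLp_contractFun (Nat.sub_add_cancel h.1).symm (Nat.add_sub_cancel' h.2).symm f g).toLp
  else 0

end FreeWigner

end

/-! Everything rests on an explicit formula for the Wigner integral. For a kernel `f` of degree `m`,
the operator `wignerL m f` sends `g` to the sum over `p` of the contractions `f ⌢ᵖ g`. It is
bounded, because Cauchy–Schwarz gives ‖f ⌢ᵖ g‖ ≤ ‖f‖‖g‖ for each of its m + 1 summands, and it maps
Ω to `f`. On pure tensors with real factors it satisfies a Chebyshev-type recursion in the fields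
(`wignerL_purePart_cons_cons`), so it lies in Γ₀; density of these tensors and norm-closedness of Γ₀
extend this to all kernels (`wignerL_mem`).

Uniqueness and the trace property come from the antiunitary J (`conjJ`), which reverses and
conjugates kernels. It turns left fields into right fields, and these commute with left fields, so J
Γ₀ J commutes with Γ₀ (`conjOp_mul_comm`). Every `g` in a particle space is RΩ for some R in J Γ₀ J;
hence Ω is separating for Γ₀ (`eq_of_vacuum_eq`), A*Ω = JAΩ for A in Γ₀ (`star_vacuum`), and τ₀ is a
trace (`trace_mul_comm`).

The moments are then read off from τ₀(ABCD) = ⟨BAΩ, CDΩ⟩ for self-adjoint A, B, since contractions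
of different orders lie in orthogonal degrees. Thus τ₀(X⁴) is the sum of the ‖f ⌢ᵖ f‖², whose terms
p = 0 and p = m both equal ‖f‖⁴ and cancel 2τ₀(X²)². By traciality τ₀(X²Y²) is the sum of the ‖f ⌢ᵖ
g‖², and its p = 0 term cancels τ₀(X²)τ₀(Y²). Finally τ₀(XYXY) is the sum of the Re⟨g ⌢ᵖ f, f ⌢ᵖ g⟩.
Its terms p = 0 and p = m ∧ n have equal real parts (`inner_contraction_zero_swap`), which is what
completes the squares and accounts for the additional square at p = m ∧ n.

In the expansion of τ₀((X+Y)⁴), opposite parity kills the words with one letter occurring three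
times, and traciality reduces the six remaining mixed words to four copies of X²Y² and two of XYXY.
-/

noncomputable section

namespace FreeWigner

/-! ### The inclusion of the `n`-particle spaces -/

theorem incl_apply_self {n : ℕ} (f : Particle n) : (incl f : Fock) n = f := by
  simp [incl]

theorem incl_apply_ne {n k : ℕ} (f : Particle n) (h : k ≠ n) : (incl f : Fock) k = 0 := by
  simp [incl, h]

theorem norm_incl {n : ℕ} (f : Particle n) : ‖incl f‖ = ‖f‖ :=
  lp.norm_single (by norm_num) n f

theorem incl_injective {n : ℕ} : Function.Injective (incl (n := n)) := fun f g h => by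
  rw [← incl_apply_self f, h, incl_apply_self]

theorem incl_add {n : ℕ} (f g : Particle n) : incl (f + g) = incl f + incl g :=
  lp.single_add _ _ _ _

theorem incl_smul {n : ℕ} (c : ℂ) (f : Particle n) : incl (c • f) = c • incl f :=
  lp.single_smul _ _ _ _

/-- The inclusion of the `n`-particle space as a continuous linear map. -/
def inclL (n : ℕ) : Particle n →L[ℂ] Fock :=
  LinearMap.mkContinuous ⟨⟨incl, incl_add⟩, incl_smul⟩ 1 fun f => by
    simp [norm_incl]

theorem inner_incl_left {n : ℕ} (f : Particle n) (F : Fock) :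
    inner ℂ (incl f) F = inner ℂ f (F n) := lp.inner_single_left n f F

theorem inner_incl_right {n : ℕ} (f : Particle n) (F : Fock) :
    inner ℂ F (incl f) = inner ℂ (F n) f := lp.inner_single_right n f F

theorem inner_incl_incl {n : ℕ} (f g : Particle n) : inner ℂ (incl f) (incl g) = inner ℂ f g := by
  rw [inner_incl_left, incl_apply_self]

theorem inner_incl_of_ne {m n : ℕ} (h : m ≠ n) (f : Particle m) (g : Particle n) :
    inner ℂ (incl f) (incl g) = 0 := by
  rw [inner_incl_left, incl_apply_ne _ h, inner_zero_right]

/-- Degrees that are equal only propositionally give different types; passing to the Fock space lets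
such kernels be compared without casts. -/
theorem incl_toLp_congr {m n : ℕ} (h : m = n) {F : (Fin m → ℝ) → ℂ} {G : (Fin n → ℝ) → ℂ}
    (hF : MemLp F 2 (cube m)) (hG : MemLp G 2 (cube n))
    (hFG : F =ᵐ[cube m] fun u => G fun i => u (Fin.cast h.symm i)) :
    incl hF.toLp = incl hG.toLp := by
  subst h
  rw [MemLp.toLp_congr hF hG hFG]

theorem memLp_cast {m n : ℕ} (h : m = n) {F : (Fin m → ℝ) → ℂ} (hF : MemLp F 2 (cube m)) :
    MemLp (fun u : Fin n → ℝ => F fun i => u (Fin.cast h i)) 2 (cube n) := by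
  subst h
  exact hF

/-! ### Pure tensors -/

/-- The pure tensor `h₁ ⊗ ⋯ ⊗ hₙ` in the `n`-particle space. -/
def purePart : (l : List H) → Particle l.length
  | [] => memLp_one.toLp
  | h :: l => tensor h (purePart l)

/-- The function `h₁(t₁) ⋯ hₙ(tₙ)`. -/
def prodFun : (l : List H) → (Fin l.length → ℝ) → ℂ
  | [], _ => 1
  | h :: l, u => h (u 0) * prodFun l fun i => u i.succ

/-- The pure tensor `h₁ ⊗ ⋯ ⊗ hₙ` in the full Fock space. -/
def pureTensor (l : List H) : Fock := incl (purePart l)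

theorem pureTensor_nil : pureTensor [] = vacuum := rfl

theorem coeFn_purePart (l : List H) : purePart l =ᵐ[cube l.length] prodFun l := by
  induction l with
  | nil => exact MemLp.coeFn_toLp memLp_one
  | cons h l ih =>
    refine (MemLp.coeFn_toLp (memLp_tensorFun h (purePart l))).trans ?_
    filter_upwards [ae_cons ih] with u hu
    simp only [tensorFun, prodFun, hu]

theorem memLp_prodFun (l : List H) : MemLp (prodFun l) 2 (cube l.length) :=
  (memLp_congr_ae (coeFn_purePart l)).1 (Lp.memLp _)

theorem toLp_prodFun (l : List H) : (memLp_prodFun l).toLp = purePart l := by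
  rw [MemLp.toLp_congr _ (Lp.memLp (purePart l)) (coeFn_purePart l).symm, Lp.toLp_coeFn]

theorem creation_apply_zero (h : H) (F : Fock) : (creation h F : Fock) 0 = 0 := rfl

theorem creation_apply_succ (h : H) (F : Fock) (n : ℕ) :
    (creation h F : Fock) (n + 1) = tensor h (F n) := rfl

theorem tensor_zero {n : ℕ} (h : H) : tensor h (0 : Particle n) = 0 := by
  simpa using tensor_smul h 0 (0 : Particle n)

theorem creation_incl {n : ℕ} (h : H) (φ : Particle n) :
    creation h (incl φ) = incl (tensor h φ) := by
  ext1
  funext k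
  cases k with
  | zero => rw [creation_apply_zero, incl_apply_ne _ (by omega)]
  | succ k =>
    rw [creation_apply_succ]
    by_cases hk : k = n
    · subst hk
      rw [incl_apply_self, incl_apply_self]
    · rw [incl_apply_ne _ hk, incl_apply_ne _ (by omega), tensor_zero]

theorem creation_pureTensor (h : H) (l : List H) :
    creation h (pureTensor l) = pureTensor (h :: l) := creation_incl h _

theorem inner_tensor {n : ℕ} (h k : H) (φ ψ : Particle n) :
    inner ℂ (tensor h φ) (tensor k ψ) = inner ℂ h k * inner ℂ φ ψ := by
  rw [L2.inner_def, L2.inner_def, L2.inner_def, ← integral_prod_mul]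
  have e : (fun u : Fin (n + 1) → ℝ => (u 0, fun i : Fin n => u i.succ)) =
      MeasurableEquiv.piFinSuccAbove (fun _ : Fin (n + 1) => ℝ) 0 := rfl
  have hmp := measurePreserving_cons n
  rw [e] at hmp
  rw [← hmp.integral_comp (MeasurableEquiv.measurableEmbedding _)]
  refine integral_congr_ae ?_
  filter_upwards [MemLp.coeFn_toLp (memLp_tensorFun h φ),
    MemLp.coeFn_toLp (memLp_tensorFun k ψ)] with u h1 h2
  rw [tensor, tensor, h1, h2]
  simp only [tensorFun, RCLike.inner_apply, map_mul, ← e]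
  ring

theorem adjoint_creation_vacuum (h : H) :
    ContinuousLinearMap.adjoint (creation h) vacuum = 0 := by
  refine ext_inner_left ℂ fun F => ?_
  rw [ContinuousLinearMap.adjoint_inner_right, vacuum, inner_incl_right, creation_apply_zero,
    inner_zero_left, inner_zero_right]

theorem adjoint_creation_incl_tensor {n : ℕ} (h k : H) (φ : Particle n) :
    ContinuousLinearMap.adjoint (creation h) (incl (tensor k φ)) =
      (inner ℂ h k : ℂ) • incl φ := by
  refine ext_inner_left ℂ fun F => ?_
  rw [ContinuousLinearMap.adjoint_inner_right, inner_incl_right, creation_apply_succ,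
    inner_tensor, inner_smul_right, inner_incl_right]

theorem adjoint_creation_pureTensor (h k : H) (l : List H) :
    ContinuousLinearMap.adjoint (creation h) (pureTensor (k :: l)) =
      (inner ℂ h k : ℂ) • pureTensor l := adjoint_creation_incl_tensor h k _

/-- The product `⟨h₁, k₁⟩ ⋯ ⟨hₙ, kₙ⟩`. -/
def listInner : List H → List H → ℂ
  | h :: l, k :: l' => inner ℂ h k * listInner l l'
  -- Lists of different lengths are truncated to the shorter one, so the link with the inner product
  -- of tensors requires equal lengths.
  | _, _ => 1

theorem inner_pureTensor : ∀ {l l' : List H}, l.length = l'.length →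
    inner ℂ (pureTensor l) (pureTensor l') = listInner l l'
  | [], [], _ => by
    have h : ‖(memLp_one.toLp : Particle 0)‖ = 1 := by
      rw [Lp.norm_toLp, cube, Measure.pi_of_empty]
      simp
    rw [pureTensor_nil, vacuum, inner_incl_incl, inner_self_eq_norm_sq_to_K, h]
    simp [listInner]
  | h :: l, k :: l', hl => by
    rw [← creation_pureTensor, ← ContinuousLinearMap.adjoint_inner_right,
      adjoint_creation_pureTensor, inner_smul_right, inner_pureTensor (by simpa using hl),
      listInner]

theorem listInner_append : ∀ {A C : List H} (_ : A.length = C.length) (B D : List H),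
    listInner (A ++ B) (C ++ D) = listInner A C * listInner B D
  | [], [], _, B, D => by simp [listInner]
  | h :: l, k :: l', hl, B, D => by
    simp only [List.cons_append, listInner]
    rw [listInner_append (by simpa using hl), mul_assoc]

theorem listInner_reverse : ∀ {A C : List H} (_ : A.length = C.length),
    listInner A.reverse C.reverse = listInner A C
  | [], [], _ => by simp [listInner]
  | h :: l, k :: l', hl => by
    simp only [List.reverse_cons, listInner]
    rw [listInner_append (by simpa using hl), listInner_reverse (by simpa using hl)]
    simp [listInner, mul_comm]

theorem conj_listInner : ∀ A C : List H, (starRingEnd ℂ) (listInner A C) = listInner C A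
  | [], [] => by simp [listInner]
  | [], _ :: _ => by simp [listInner]
  | _ :: _, [] => by simp [listInner]
  | h :: l, k :: l' => by
    simp only [listInner, map_mul, conj_listInner l l', inner_conj_symm]

/-! ### Real functions -/

theorem inner_comm_of_mem_realH {h k : H} (hh : h ∈ realH) (hk : k ∈ realH) :
    (inner ℂ h k : ℂ) = inner ℂ k h := by
  rw [L2.inner_def, L2.inner_def]
  refine integral_congr_ae ?_
  filter_upwards [hh, hk] with t h1 h2
  simp [RCLike.inner_apply, Complex.conj_eq_iff_im.2 h1, Complex.conj_eq_iff_im.2 h2, mul_comm]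

theorem integral_mul_eq_inner {h : H} (hh : h ∈ realH) (k : H) :
    ∫ t, h t * k t ∂halfLine = inner ℂ h k := by
  rw [L2.inner_def]
  refine integral_congr_ae ?_
  filter_upwards [hh] with t h1
  simp [RCLike.inner_apply, Complex.conj_eq_iff_im.2 h1, mul_comm]

/-- A list of real functions. -/
def IsReal (l : List H) : Prop := ∀ h ∈ l, h ∈ realH

theorem IsReal.head {h : H} {l : List H} (hl : IsReal (h :: l)) : h ∈ realH :=
  hl h List.mem_cons_self

theorem IsReal.tail {h : H} {l : List H} (hl : IsReal (h :: l)) : IsReal l :=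
  fun k hk => hl k (List.mem_cons_of_mem _ hk)

theorem IsReal.left {A B : List H} (hl : IsReal (A ++ B)) : IsReal A :=
  fun k hk => hl k (List.mem_append_left _ hk)

theorem IsReal.right {A B : List H} (hl : IsReal (A ++ B)) : IsReal B :=
  fun k hk => hl k (List.mem_append_right _ hk)

theorem IsReal.reverse {l : List H} (hl : IsReal l) : IsReal l.reverse :=
  fun k hk => hl k (List.mem_reverse.1 hk)

theorem listInner_comm : ∀ {A C : List H}, IsReal A → IsReal C → listInner A C = listInner C A
  | [], [], _, _ => rfl
  | [], _ :: _, _, _ => rfl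
  | _ :: _, [], _, _ => rfl
  | h :: l, k :: l', h1, h2 => by
    simp only [listInner, listInner_comm h1.tail h2.tail,
      inner_comm_of_mem_realH h1.head h2.head]

theorem ae_conj_prodFun {l : List H} (hl : IsReal l) :
    ∀ᵐ u ∂cube l.length, (starRingEnd ℂ) (prodFun l u) = prodFun l u := by
  induction l with
  | nil => simp [prodFun]
  | cons h l ih =>
    have h1 : ∀ᵐ u ∂cube (l.length + 1), (h (u 0)).im = 0 :=
      (Measure.quasiMeasurePreserving_fst.comp
        (measurePreserving_cons l.length).quasiMeasurePreserving).ae hl.head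
    filter_upwards [h1, ae_cons (ih hl.tail)] with u hu hu'
    simp only [prodFun, map_mul, Complex.conj_eq_iff_im.2 hu]
    exact congrArg _ hu'

theorem append_of_lt {a b : ℕ} (t : Fin a → ℝ) (s : Fin b → ℝ) (j : Fin (a + b))
    (h : (j : ℕ) < a) : Fin.append t s j = t ⟨j, h⟩ :=
  Fin.append_left t s ⟨j, h⟩

theorem append_of_le {a b : ℕ} (t : Fin a → ℝ) (s : Fin b → ℝ) (j : Fin (a + b))
    (h : a ≤ (j : ℕ)) : Fin.append t s j = s ⟨j - a, by omega⟩ := by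
  rw [← Fin.append_right t s ⟨j - a, by omega⟩]
  exact congrArg _ (Fin.ext (by simp; omega))

theorem prodFun_append : ∀ (A B : List H) (t : Fin A.length → ℝ) (s : Fin B.length → ℝ),
    prodFun (A ++ B) (fun i => Fin.append t s (Fin.cast List.length_append i)) =
      prodFun A t * prodFun B s
  | [], B, t, s => by
    simp only [prodFun, one_mul]
    change prodFun B _ = _
    congr 1
    funext i
    rw [append_of_le _ _ _ (Nat.zero_le _)]
    rfl
  | h :: A, B, t, s => by
    rw [prodFun, mul_assoc, ← prodFun_append A B]
    change h _ * prodFun (A ++ B) _ = _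
    congr 1
    congr 1
    funext i
    have hi : (i : ℕ) < (A ++ B).length := i.2
    rw [List.length_append] at hi
    by_cases hA : (i : ℕ) < A.length
    · rw [append_of_lt _ _ _ (show _ < A.length from hA)]
      exact append_of_lt t s _ (Nat.succ_lt_succ hA)
    · rw [append_of_le _ _ _ (show A.length ≤ _ from not_lt.1 hA)]
      refine (append_of_le t s _ (Nat.succ_le_succ (not_lt.1 hA))).trans ?_
      exact congrArg s (Fin.ext (by simp))

theorem prodFun_reverse (l : List H) (u : Fin l.length → ℝ) :
    prodFun l.reverse (fun i => u (Fin.cast List.length_reverse i).rev) = prodFun l u := by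
  induction l with
  | nil => rfl
  | cons h l ih =>
    have e := prodFun_append l.reverse [h]
      (fun i => u (Fin.cast List.length_reverse i).rev.succ) fun _ => u 0
    rw [ih fun i => u i.succ] at e
    rw [prodFun, mul_comm]
    have e2 : prodFun [h] (fun _ => u 0) = h (u 0) := by simp [prodFun]
    rw [← e2, ← e]
    -- The type of the argument of `prodFun` depends on the list, so equality of lists is
    -- transported with an arbitrary pair of arguments.
    have key : ∀ (L L' : List H) (hL : L = L') (v : Fin L.length → ℝ) (w : Fin L'.length → ℝ),
        (∀ i, v i = w (Fin.cast (by rw [hL]) i)) → prodFun L v = prodFun L' w := by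
      intro L L' hL v w hv
      subst hL
      exact congrArg _ (funext hv)
    refine key _ _ List.reverse_cons _ _ fun i => ?_
    have hi : (i : ℕ) < (h :: l).length := i.2.trans_eq List.length_reverse
    rw [List.length_cons] at hi
    by_cases hi' : (i : ℕ) < l.length
    · rw [append_of_lt _ _ _ (show _ < l.reverse.length by simpa using hi')]
      exact congrArg u (Fin.ext (by simp; omega))
    · rw [append_of_le _ _ _ (show l.reverse.length ≤ _ by simpa using hi')]
      exact congrArg u (Fin.ext (by simp; omega))

theorem integral_prodFun_mul : ∀ {B C : List H} (hBC : B.length = C.length), IsReal B →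
    ∫ s, prodFun B s * prodFun C (fun i => s (Fin.cast hBC.symm i)) ∂cube B.length =
      listInner B C
  | [], [], _, _ => by
    change ∫ _, (1 : ℂ) * 1 ∂cube 0 = 1
    rw [cube, Measure.pi_of_empty]
    simp
  | h :: B, k :: C, hBC, hB => by
    have ih := integral_prodFun_mul (B := B) (C := C) (by simpa using hBC) hB.tail
    rw [listInner, ← ih, ← integral_mul_eq_inner hB.head k, ← integral_prod_mul]
    have e : (fun u : Fin (B.length + 1) → ℝ => (u 0, fun i : Fin B.length => u i.succ)) =
      MeasurableEquiv.piFinSuccAbove (fun _ : Fin (B.length + 1) => ℝ) 0 := rfl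
    have hmp := measurePreserving_cons B.length
    rw [e] at hmp
    rw [← hmp.integral_comp (MeasurableEquiv.measurableEmbedding _), ← e]
    refine integral_congr_ae (Filter.Eventually.of_forall fun u => ?_)
    change h (u 0) * prodFun B _ * (k (u 0) * prodFun C _) =
      h (u 0) * k (u 0) * (prodFun B _ * prodFun C _)
    rw [mul_mul_mul_comm]
    rfl

/-! ### Composition of square integrable kernels -/

section Kernel

set_option linter.unusedSectionVars false

variable {α β κ : Type*} [MeasurableSpace α] [MeasurableSpace β] [MeasurableSpace κ]
  {μ : Measure α} {ν : Measure β} {ρ : Measure κ} [SFinite μ] [SFinite ν] [SFinite ρ]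
  {F F' : α × κ → ℂ} {G G' : κ × β → ℂ}

/-- The composition of two kernels. -/
def kernelComp (ρ : Measure κ) (F : α × κ → ℂ) (G : κ × β → ℂ) (z : α × β) : ℂ :=
  ∫ s, F (z.1, s) * G (s, z.2) ∂ρ

theorem ae_memLp_left (hF : MemLp F 2 (μ.prod ρ)) :
    ∀ᵐ t ∂μ, MemLp (fun s => F (t, s)) 2 ρ := by
  have h1 := eLpNorm_two_lt_top.1 hF.2
  rw [lintegral_prod _ (hF.1.enorm.pow_const _)] at h1
  filter_upwards [hF.1.prodMk_left,
    ae_lt_top' (hF.1.enorm.pow_const _).lintegral_prod_right' h1.ne] with t h2 h3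
  exact ⟨h2, eLpNorm_two_lt_top.2 h3⟩

theorem ae_memLp_right (hG : MemLp G 2 (ρ.prod ν)) :
    ∀ᵐ r ∂ν, MemLp (fun s => G (s, r)) 2 ρ :=
  ae_memLp_left (F := fun z : β × κ => G (z.2, z.1))
    (hG.comp_measurePreserving Measure.measurePreserving_swap)

theorem ae_integrable_kernel (hF : MemLp F 2 (μ.prod ρ)) (hG : MemLp G 2 (ρ.prod ν)) :
    ∀ᵐ z ∂μ.prod ν, Integrable (fun s => F (z.1, s) * G (s, z.2)) ρ := by
  filter_upwards [Measure.quasiMeasurePreserving_fst.ae (ae_memLp_left hF),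
    Measure.quasiMeasurePreserving_snd.ae (ae_memLp_right hG)] with z h1 h2
  exact h1.integrable_mul h2

theorem kernelComp_congr (hF : F =ᵐ[μ.prod ρ] F') (hG : G =ᵐ[ρ.prod ν] G') :
    kernelComp ρ F G =ᵐ[μ.prod ν] kernelComp ρ F' G' := by
  have h2 : ∀ᵐ z ∂ν.prod ρ, G (z.2, z.1) = G' (z.2, z.1) :=
    Measure.measurePreserving_swap.quasiMeasurePreserving.ae hG
  filter_upwards [Measure.quasiMeasurePreserving_fst.ae (Measure.ae_ae_of_ae_prod hF),
    Measure.quasiMeasurePreserving_snd.ae (Measure.ae_ae_of_ae_prod h2)] with z h1 h2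
  refine integral_congr_ae ?_
  filter_upwards [h1, h2] with s h3 h4
  rw [h3, h4]

theorem kernelComp_add_left (hF : MemLp F 2 (μ.prod ρ)) (hF' : MemLp F' 2 (μ.prod ρ))
    (hG : MemLp G 2 (ρ.prod ν)) :
    kernelComp ρ (F + F') G =ᵐ[μ.prod ν] kernelComp ρ F G + kernelComp ρ F' G := by
  filter_upwards [ae_integrable_kernel hF hG, ae_integrable_kernel hF' hG] with z h1 h2
  simp only [kernelComp, Pi.add_apply, add_mul]
  exact integral_add h1 h2

theorem kernelComp_add_right (hF : MemLp F 2 (μ.prod ρ)) (hG : MemLp G 2 (ρ.prod ν))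
    (hG' : MemLp G' 2 (ρ.prod ν)) :
    kernelComp ρ F (G + G') =ᵐ[μ.prod ν] kernelComp ρ F G + kernelComp ρ F G' := by
  filter_upwards [ae_integrable_kernel hF hG, ae_integrable_kernel hF hG'] with z h1 h2
  simp only [kernelComp, Pi.add_apply, mul_add]
  exact integral_add h1 h2

theorem kernelComp_smul_left (c : ℂ) : kernelComp ρ (c • F) G = c • kernelComp ρ F G := by
  funext z
  simp only [kernelComp, Pi.smul_apply, smul_eq_mul, mul_assoc]
  exact integral_const_mul _ _

theorem kernelComp_smul_right (c : ℂ) : kernelComp ρ F (c • G) = c • kernelComp ρ F G := by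
  funext z
  simp only [kernelComp, Pi.smul_apply, smul_eq_mul, mul_left_comm _ c]
  exact integral_const_mul _ _

theorem eLpNorm_two_sq {γ : Type*} [MeasurableSpace γ] {σ : Measure γ} (f : γ → ℂ) :
    eLpNorm f 2 σ ^ (2 : ℝ) = ∫⁻ x, ‖f x‖ₑ ^ (2 : ℝ) ∂σ := by
  rw [eLpNorm_eq_lintegral_rpow_enorm_toReal (p := 2) (by norm_num) (by norm_num),
    ← ENNReal.rpow_mul]
  norm_num

/-- The Hilbert–Schmidt norm is submultiplicative: Cauchy–Schwarz in the contracted variable, then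
Tonelli in the two free ones. -/
theorem eLpNorm_kernelComp_le (hF : MemLp F 2 (μ.prod ρ)) (hG : MemLp G 2 (ρ.prod ν)) :
    eLpNorm (kernelComp ρ F G) 2 (μ.prod ν) ≤ eLpNorm F 2 (μ.prod ρ) * eLpNorm G 2 (ρ.prod ν) := by
  rw [← ENNReal.rpow_le_rpow_iff (z := 2) (by norm_num),
    ENNReal.mul_rpow_of_nonneg _ _ (by norm_num), eLpNorm_two_sq, eLpNorm_two_sq, eLpNorm_two_sq,
    lintegral_prod _ (hF.1.enorm.pow_const _), lintegral_prod_symm _ (hG.1.enorm.pow_const _),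
    ← lintegral_prod_mul (hF.1.enorm.pow_const _).lintegral_prod_right'
      (hG.1.enorm.pow_const _).lintegral_prod_left']
  refine lintegral_mono_ae ?_
  filter_upwards [Measure.quasiMeasurePreserving_fst.ae (ae_memLp_left hF),
    Measure.quasiMeasurePreserving_snd.ae (ae_memLp_right hG)] with z h1 h2
  have h3 := ENNReal.lintegral_mul_le_Lp_mul_Lq ρ Real.HolderConjugate.two_two
    h1.1.enorm h2.1.enorm
  have h4 : ‖∫ s, F (z.1, s) * G (s, z.2) ∂ρ‖ₑ ≤
      (∫⁻ s, ‖F (z.1, s)‖ₑ ^ (2 : ℝ) ∂ρ) ^ (1 / 2 : ℝ) *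
        (∫⁻ s, ‖G (s, z.2)‖ₑ ^ (2 : ℝ) ∂ρ) ^ (1 / 2 : ℝ) := by
    refine (enorm_integral_le_lintegral_enorm _).trans ?_
    simp only [enorm_mul]
    exact h3
  refine (ENNReal.rpow_le_rpow h4 (by norm_num)).trans ?_
  rw [ENNReal.mul_rpow_of_nonneg _ _ (by norm_num), ← ENNReal.rpow_mul, ← ENNReal.rpow_mul]
  norm_num

end Kernel

/-! ### Contractions as a bounded bilinear map -/

section Contract

variable {a b k : ℕ}

theorem measurePreserving_append_rev (k b : ℕ) :
    MeasurePreserving (fun z : (Fin k → ℝ) × (Fin b → ℝ) =>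
      Fin.append (fun i : Fin k => z.1 i.rev) z.2) ((cube k).prod (cube b)) (cube (k + b)) :=
  (measurePreserving_append k b).comp
    ((measurePreserving_rev k).prod (MeasurePreserving.id (cube b)))

/-- The kernel of a function on `ℝ₊^(a+k)` used as the left factor of a contraction. -/
def leftKernel (a k : ℕ) (f : (Fin (a + k) → ℝ) → ℂ) (z : (Fin a → ℝ) × (Fin k → ℝ)) : ℂ :=
  f (Fin.append z.1 z.2)

/-- The kernel of a function on `ℝ₊^(k+b)` used as the right factor of a contraction. -/
def rightKernel (k b : ℕ) (g : (Fin (k + b) → ℝ) → ℂ) (z : (Fin k → ℝ) × (Fin b → ℝ)) : ℂ :=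
  g (Fin.append (fun i : Fin k => z.1 i.rev) z.2)

theorem memLp_leftKernel {f : (Fin (a + k) → ℝ) → ℂ} (hf : MemLp f 2 (cube (a + k))) :
    MemLp (leftKernel a k f) 2 ((cube a).prod (cube k)) :=
  hf.comp_measurePreserving (measurePreserving_append a k)

theorem memLp_rightKernel {g : (Fin (k + b) → ℝ) → ℂ} (hg : MemLp g 2 (cube (k + b))) :
    MemLp (rightKernel k b g) 2 ((cube k).prod (cube b)) :=
  hg.comp_measurePreserving (measurePreserving_append_rev k b)

theorem leftKernel_congr {f f' : (Fin (a + k) → ℝ) → ℂ} (h : f =ᵐ[cube (a + k)] f') :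
    leftKernel a k f =ᵐ[(cube a).prod (cube k)] leftKernel a k f' :=
  (measurePreserving_append a k).quasiMeasurePreserving.ae h

theorem rightKernel_congr {g g' : (Fin (k + b) → ℝ) → ℂ} (h : g =ᵐ[cube (k + b)] g') :
    rightKernel k b g =ᵐ[(cube k).prod (cube b)] rightKernel k b g' :=
  (measurePreserving_append_rev k b).quasiMeasurePreserving.ae h

/-- The contraction of two functions. -/
def contractKernel (a b k : ℕ) (f : (Fin (a + k) → ℝ) → ℂ) (g : (Fin (k + b) → ℝ) → ℂ)
    (u : Fin (a + b) → ℝ) : ℂ :=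
  kernelComp (cube k) (leftKernel a k f) (rightKernel k b g)
    (fun i : Fin a => u (Fin.castAdd b i), fun i : Fin b => u (Fin.natAdd a i))

theorem contractKernel_of_ae {f f' : (Fin (a + k) → ℝ) → ℂ} {g g' : (Fin (k + b) → ℝ) → ℂ}
    (hf : f =ᵐ[cube (a + k)] f') (hg : g =ᵐ[cube (k + b)] g') :
    contractKernel a b k f g =ᵐ[cube (a + b)] contractKernel a b k f' g' :=
  (measurePreserving_split a b).quasiMeasurePreserving.ae
    (kernelComp_congr (leftKernel_congr hf) (rightKernel_congr hg))

/-- The contraction of `f ∈ H^{⊗ (a+k)}` and `g ∈ H^{⊗ (k+b)}` as an element of `H^{⊗ (a+b)}`. -/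
def contractPart (f : Particle (a + k)) (g : Particle (k + b)) : Particle (a + b) :=
  (memLp_contractFun rfl rfl f g).toLp

theorem contraction_eq_incl (f : Particle (a + k)) (g : Particle (k + b)) :
    contraction k f g = incl (contractPart f g) := by
  -- `contraction` computes the numbers of free variables by truncated subtraction; generalizing
  -- them allows substitution.
  have key : ∀ {a' b' : ℕ} (ha : a + k = a' + k) (hb : k + b = k + b'),
      incl (memLp_contractFun ha hb f g).toLp = incl (contractPart f g) := by
    intro a' b' ha hb
    obtain rfl : a = a' := by omega
    obtain rfl : b = b' := by omega
    rfl
  rw [contraction, dif_pos ⟨by omega, by omega⟩]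
  exact key _ _

theorem contraction_of_not_le {m n p : ℕ} (h : ¬ (p ≤ m ∧ p ≤ n)) (f : Particle m)
    (g : Particle n) : contraction p f g = 0 := dif_neg h

theorem contractPart_add_left (f f' : Particle (a + k)) (g : Particle (k + b)) :
    contractPart (f + f') g = contractPart f g + contractPart f' g := by
  rw [contractPart, contractPart, contractPart, ← MemLp.toLp_add]
  refine MemLp.toLp_congr _ _ ?_
  refine (contractKernel_of_ae (Lp.coeFn_add f f') .rfl).trans ?_
  exact (measurePreserving_split a b).quasiMeasurePreserving.ae
    (kernelComp_add_left (memLp_leftKernel (Lp.memLp f)) (memLp_leftKernel (Lp.memLp f'))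
      (memLp_rightKernel (Lp.memLp g)))

theorem contractPart_add_right (f : Particle (a + k)) (g g' : Particle (k + b)) :
    contractPart f (g + g') = contractPart f g + contractPart f g' := by
  rw [contractPart, contractPart, contractPart, ← MemLp.toLp_add]
  refine MemLp.toLp_congr _ _ ?_
  refine (contractKernel_of_ae .rfl (Lp.coeFn_add g g')).trans ?_
  exact (measurePreserving_split a b).quasiMeasurePreserving.ae
    (kernelComp_add_right (memLp_leftKernel (Lp.memLp f)) (memLp_rightKernel (Lp.memLp g))
      (memLp_rightKernel (Lp.memLp g')))

theorem contractPart_smul_left (c : ℂ) (f : Particle (a + k)) (g : Particle (k + b)) :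
    contractPart (c • f) g = c • contractPart f g := by
  rw [contractPart, contractPart, ← MemLp.toLp_const_smul]
  refine MemLp.toLp_congr _ _ ?_
  refine (contractKernel_of_ae (Lp.coeFn_smul c f) .rfl).trans (.of_forall fun u => ?_)
  exact congrFun (kernelComp_smul_left c) _

theorem contractPart_smul_right (c : ℂ) (f : Particle (a + k)) (g : Particle (k + b)) :
    contractPart f (c • g) = c • contractPart f g := by
  rw [contractPart, contractPart, ← MemLp.toLp_const_smul]
  refine MemLp.toLp_congr _ _ ?_
  refine (contractKernel_of_ae .rfl (Lp.coeFn_smul c g)).trans (.of_forall fun u => ?_)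
  exact congrFun (kernelComp_smul_right c) _

theorem eLpNorm_leftKernel {f : (Fin (a + k) → ℝ) → ℂ} (hf : MemLp f 2 (cube (a + k))) :
    eLpNorm (leftKernel a k f) 2 ((cube a).prod (cube k)) = eLpNorm f 2 (cube (a + k)) :=
  eLpNorm_comp_measurePreserving hf.1 (measurePreserving_append a k)

theorem eLpNorm_rightKernel {g : (Fin (k + b) → ℝ) → ℂ} (hg : MemLp g 2 (cube (k + b))) :
    eLpNorm (rightKernel k b g) 2 ((cube k).prod (cube b)) = eLpNorm g 2 (cube (k + b)) :=
  eLpNorm_comp_measurePreserving hg.1 (measurePreserving_append_rev k b)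

theorem eLpNorm_contractKernel_le {f : (Fin (a + k) → ℝ) → ℂ} {g : (Fin (k + b) → ℝ) → ℂ}
    (hf : MemLp f 2 (cube (a + k))) (hg : MemLp g 2 (cube (k + b))) :
    eLpNorm (contractKernel a b k f g) 2 (cube (a + b)) ≤
      eLpNorm f 2 (cube (a + k)) * eLpNorm g 2 (cube (k + b)) := by
  have hF := memLp_leftKernel hf
  have hG := memLp_rightKernel hg
  rw [← eLpNorm_leftKernel hf, ← eLpNorm_rightKernel hg]
  refine le_trans (le_of_eq ?_) (eLpNorm_kernelComp_le hF hG)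
  exact eLpNorm_comp_measurePreserving (memLp_kernel_comp hF hG).1 (measurePreserving_split a b)

theorem norm_contractPart_le (f : Particle (a + k)) (g : Particle (k + b)) :
    ‖contractPart f g‖ ≤ ‖f‖ * ‖g‖ := by
  rw [contractPart, Lp.norm_toLp, Lp.norm_def, Lp.norm_def, ← ENNReal.toReal_mul]
  exact ENNReal.toReal_mono
    (ENNReal.mul_ne_top (Lp.eLpNorm_ne_top f) (Lp.eLpNorm_ne_top g))
    (eLpNorm_contractKernel_le (Lp.memLp f) (Lp.memLp g))

end Contract

variable {m n : ℕ}

theorem norm_contraction_le {p : ℕ} (f : Particle m) (g : Particle n) :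
    ‖contraction p f g‖ ≤ ‖f‖ * ‖g‖ := by
  by_cases h : p ≤ m ∧ p ≤ n
  · obtain ⟨⟨a, rfl⟩, ⟨b, rfl⟩⟩ := And.imp Nat.exists_eq_add_of_le' Nat.exists_eq_add_of_le h
    rw [contraction_eq_incl, norm_incl]
    exact norm_contractPart_le f g
  · rw [contraction_of_not_le h, norm_zero]
    positivity

/-- The contraction `f ⌢ᵖ g` as a continuous bilinear map. -/
def contractionL (m n p : ℕ) : Particle m →L[ℂ] Particle n →L[ℂ] Fock :=
  LinearMap.mkContinuous₂
    (LinearMap.mk₂ ℂ (contraction (m := m) (n := n) p)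
      (fun f f' g => by
        by_cases h : p ≤ m ∧ p ≤ n
        · obtain ⟨⟨a, rfl⟩, ⟨b, rfl⟩⟩ := And.imp Nat.exists_eq_add_of_le' Nat.exists_eq_add_of_le h
          simp only [contraction_eq_incl, contractPart_add_left, incl_add]
        · simp [contraction_of_not_le h])
      (fun c f g => by
        by_cases h : p ≤ m ∧ p ≤ n
        · obtain ⟨⟨a, rfl⟩, ⟨b, rfl⟩⟩ := And.imp Nat.exists_eq_add_of_le' Nat.exists_eq_add_of_le h
          simp only [contraction_eq_incl, contractPart_smul_left, incl_smul]
        · simp [contraction_of_not_le h])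
      (fun f g g' => by
        by_cases h : p ≤ m ∧ p ≤ n
        · obtain ⟨⟨a, rfl⟩, ⟨b, rfl⟩⟩ := And.imp Nat.exists_eq_add_of_le' Nat.exists_eq_add_of_le h
          simp only [contraction_eq_incl, contractPart_add_right, incl_add]
        · simp [contraction_of_not_le h])
      (fun c f g => by
        by_cases h : p ≤ m ∧ p ≤ n
        · obtain ⟨⟨a, rfl⟩, ⟨b, rfl⟩⟩ := And.imp Nat.exists_eq_add_of_le' Nat.exists_eq_add_of_le h
          simp only [contraction_eq_incl, contractPart_smul_right, incl_smul]
        · simp [contraction_of_not_le h]))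
    1 (fun f g => by
      rw [LinearMap.mk₂_apply, one_mul]
      exact norm_contraction_le f g)

theorem contractionL_apply {p : ℕ} (f : Particle m) (g : Particle n) :
    contractionL m n p f g = contraction p f g := rfl

/-- Lets a kernel be replaced by a pure tensor whose length equals its degree only propositionally.
-/
theorem contraction_congr {m m' n n' : ℕ} {f : Particle m} {f' : Particle m'} {g : Particle n}
    {g' : Particle n'} (p : ℕ) (hm : m = m') (hn : n = n') (hf : incl f = incl f')
    (hg : incl g = incl g') : contraction p f g = contraction p f' g' := by
  subst hm hn
  rw [incl_injective hf, incl_injective hg]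

/-! ### Contractions of pure tensors -/

/-- The contraction reads the first variables of the right factor backwards, so writing that block
as `C.reverse` pairs `B` and `C` in order. Realness of `B` is what turns the bilinear integral into
the sesquilinear inner product. -/
theorem contraction_purePart {A B C D : List H} (hBC : B.length = C.length) (hB : IsReal B) :
    contraction B.length (purePart (A ++ B)) (purePart (C.reverse ++ D)) =
      listInner B C • pureTensor (A ++ D) := by
  have hm : (A ++ B).length = A.length + B.length := List.length_append
  have hn : (C.reverse ++ D).length = B.length + D.length := by
    rw [List.length_append, List.length_reverse, hBC]
  have hf := memLp_cast hm (memLp_prodFun (A ++ B))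
  have hg := memLp_cast hn (memLp_prodFun (C.reverse ++ D))
  rw [contraction_congr (f' := hf.toLp) (g' := hg.toLp) _ hm hn
    (by rw [← toLp_prodFun]; exact incl_toLp_congr hm _ _ (.of_forall fun _ => rfl))
    (by rw [← toLp_prodFun]; exact incl_toLp_congr hn _ _ (.of_forall fun _ => rfl)),
    contraction_eq_incl, pureTensor, ← incl_smul, ← toLp_prodFun, ← MemLp.toLp_const_smul]
  refine incl_toLp_congr List.length_append.symm _ _ ?_
  refine (contractKernel_of_ae (MemLp.coeFn_toLp hf) (MemLp.coeFn_toLp hg)).trans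
    (.of_forall fun u => ?_)
  have e1 := prodFun_append A D (fun i => u (Fin.castAdd D.length i))
    fun i => u (Fin.natAdd A.length i)
  have e2 : (fun i : Fin (A ++ D).length => Fin.append (fun i => u (Fin.castAdd D.length i))
      (fun i => u (Fin.natAdd A.length i)) (Fin.cast List.length_append i)) =
      fun i => u (Fin.cast List.length_append i) := by
    funext i
    exact congrFun (Fin.append_castAdd_natAdd (f := u)) _
  rw [e2] at e1
  change _ = listInner B C * prodFun (A ++ D) _
  rw [e1, ← integral_prodFun_mul hBC hB, ← integral_mul_const]
  refine integral_congr_ae (.of_forall fun s => ?_)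
  have e3 := prodFun_append A B (fun i => u (Fin.castAdd D.length i)) s
  have e4 := prodFun_append C.reverse D
    (fun i => s (Fin.cast (by rw [List.length_reverse, hBC]) i).rev)
    fun i => u (Fin.natAdd A.length i)
  have e5 := prodFun_reverse C fun i => s (Fin.cast hBC.symm i)
  have e6 : leftKernel A.length B.length (fun u => prodFun (A ++ B) fun i => u (Fin.cast hm i))
      (fun i => u (Fin.castAdd D.length i), s) = _ := e3
  have e7 : rightKernel B.length D.length
      (fun u => prodFun (C.reverse ++ D) fun i => u (Fin.cast hn i))
      (s, fun i => u (Fin.natAdd A.length i)) =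
      prodFun C (fun i => s (Fin.cast hBC.symm i)) *
        prodFun D fun i => u (Fin.natAdd A.length i) := by
    rw [← e5]
    refine Eq.trans ?_ (e4.trans ?_)
    · simp only [rightKernel]
      congr 1
      funext i
      by_cases hA : (i : ℕ) < C.length
      · rw [append_of_lt _ _ _ (show _ < B.length from hA.trans_eq hBC.symm),
          append_of_lt _ _ _ (show _ < C.reverse.length by simpa using hA)]
        rfl
      · rw [append_of_le _ _ _ (show B.length ≤ _ from hBC.trans_le (not_lt.1 hA)),
          append_of_le _ _ _ (show C.reverse.length ≤ _ by simpa using hA)]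
        exact congrArg u (Fin.ext (by simp [hBC]))
    · congr 2
      funext i
      exact congrArg s (Fin.ext (by simp [hBC]))
  change leftKernel A.length B.length _ (_, s) * rightKernel B.length D.length _ (s, _) = _
  rw [e6, e7]
  ring

theorem contraction_purePart_of_eq {A B C D l l' : List H} {p : ℕ} (hl : l = A ++ B)
    (hl' : l' = C.reverse ++ D) (hp : p = B.length) (hBC : B.length = C.length) (hB : IsReal B) :
    contraction p (purePart l) (purePart l') = listInner B C • pureTensor (A ++ D) := by
  subst hl hl' hp
  exact contraction_purePart hBC hB

/-! ### Density of the real pure tensors -/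

/-- A square integrable function on `ℝ₊ⁿ` whose integral over every bounded box vanishes is zero. -/
theorem eq_zero_of_forall_box {n : ℕ} (φ : Particle n)
    (h : ∀ s : Fin n → Set ℝ, (∀ i, MeasurableSet (s i)) → (∀ i, halfLine (s i) < ∞) →
      ∫ u in univ.pi s, φ u ∂cube n = 0) : φ = 0 := by
  -- `φ` is only square integrable, so it need not be integrable. On each of these cubes, of finite
  -- measure, it is, and there a π-λ argument extends the vanishing from boxes to all measurable
  -- sets.
  let B : ℕ → Fin n → Set ℝ := fun N _ => Icc (-N : ℝ) N
  have hBm : ∀ N, MeasurableSet (univ.pi (B N)) := fun N =>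
    MeasurableSet.univ_pi fun _ => measurableSet_Icc
  have hBfin : ∀ N i, halfLine (B N i) < ∞ := fun N i =>
    (Measure.restrict_apply_le _ _).trans_lt measure_Icc_lt_top
  have hBμ : ∀ N, cube n (univ.pi (B N)) < ∞ := fun N => by
    rw [cube, Measure.pi_pi]
    exact ENNReal.prod_lt_top fun i _ => hBfin N i
  have hint : ∀ N, IntegrableOn φ (univ.pi (B N)) (cube n) := fun N => by
    have : IsFiniteMeasure ((cube n).restrict (univ.pi (B N))) := ⟨by
      rw [Measure.restrict_apply_univ]; exact hBμ N⟩
    exact ((Lp.memLp φ).restrict _).integrable (by norm_num)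
  have hzero : ∀ N, ∀ t : Set (Fin n → ℝ), MeasurableSet t →
      ∫ u in t, φ u ∂(cube n).restrict (univ.pi (B N)) = 0 := by
    intro N t ht
    have huniv : ∫ u, φ u ∂(cube n).restrict (univ.pi (B N)) = 0 :=
      h _ (fun _ => measurableSet_Icc) (hBfin N)
    refine MeasurableSpace.induction_on_inter
      (C := fun t _ => ∫ u in t, φ u ∂(cube n).restrict (univ.pi (B N)) = 0)
      generateFrom_pi.symm isPiSystem_pi (by simp) ?_ ?_ ?_ t ht
    · rintro t ⟨s, hs, rfl⟩
      have hs' : ∀ i, MeasurableSet (s i) := fun i => hs i (mem_univ i)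
      rw [Measure.restrict_restrict (MeasurableSet.univ_pi hs'), pi_inter_distrib.symm]
      exact h _ (fun i => (hs' i).inter measurableSet_Icc)
        fun i => (measure_mono inter_subset_right).trans_lt (hBfin N i)
    · intro t ht h0
      have := integral_add_compl ht (hint N)
      rw [h0, zero_add] at this
      rw [this, huniv]
    · intro f hd hf h0
      rw [integral_iUnion hf hd (hint N).integrableOn]
      simp [h0]
  have hB0 : ∀ N, ∀ᵐ u ∂cube n, u ∈ univ.pi (B N) → φ u = 0 := fun N => by
    rw [← ae_restrict_iff' (hBm N)]
    exact (hint N).ae_eq_zero_of_forall_setIntegral_eq_zero fun t ht _ => hzero N t ht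
  refine (Lp.eq_zero_iff_ae_eq_zero).2 ?_
  filter_upwards [ae_all_iff.2 hB0] with u hu
  obtain ⟨N, hN⟩ := exists_nat_ge (∑ i, |u i|)
  refine hu N fun i _ => abs_le.1 ?_
  exact (Finset.single_le_sum (f := fun i => |u i|) (fun i _ => abs_nonneg _)
    (Finset.mem_univ i)).trans hN

theorem prodFun_eq_prod (l : List H) (u : Fin l.length → ℝ) :
    prodFun l u = ∏ i, (l.get i) (u i) := by
  induction l with
  | nil => simp [prodFun]
  | cons h l ih =>
    rw [prodFun, ih]
    exact (Fin.prod_univ_succ (n := l.length) fun i => ((h :: l).get i) (u i)).symm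

/-- The pure tensors with real factors in the `n`-particle space. -/
def realPure (n : ℕ) : Set (Particle n) :=
  {f | ∃ l : List H, IsReal l ∧ l.length = n ∧ incl f = pureTensor l}

/-- The indicator of a box is the tensor product of the indicators of its sides, which are real
functions. -/
theorem exists_realPure_eq_indicator {n : ℕ} (s : Fin n → Set ℝ) (hs : ∀ i, MeasurableSet (s i))
    (hs' : ∀ i, halfLine (s i) < ∞) :
    ∃ f ∈ realPure n, f =ᵐ[cube n] (univ.pi s).indicator fun _ => (1 : ℂ) := by
  let v : Fin n → H := fun i => indicatorConstLp 2 (hs i) (hs' i).ne 1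
  have hv : ∀ i, v i =ᵐ[halfLine] (s i).indicator fun _ => (1 : ℂ) := fun i => indicatorConstLp_coeFn
  have hlen : (List.ofFn v).length = n := List.length_ofFn
  have hF := memLp_cast hlen (memLp_prodFun (List.ofFn v))
  refine ⟨hF.toLp, ⟨List.ofFn v, ?_, hlen, ?_⟩, ?_⟩
  · intro h hh
    obtain ⟨i, rfl⟩ := List.mem_ofFn.1 hh
    change ∀ᵐ t ∂halfLine, (v i t).im = 0
    filter_upwards [hv i] with t ht
    rw [ht]
    by_cases hts : t ∈ s i <;> simp [hts]
  · rw [pureTensor, ← toLp_prodFun]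
    exact incl_toLp_congr hlen.symm _ _ (.of_forall fun u => rfl)
  · refine (MemLp.coeFn_toLp hF).trans ?_
    have : ∀ᵐ u ∂cube n, ∀ i, v i (u i) = (s i).indicator (fun _ => (1 : ℂ)) (u i) :=
      ae_all_iff.2 fun i => (Measure.quasiMeasurePreserving_eval (fun _ : Fin n => halfLine) i).ae (hv i)
    filter_upwards [this] with u hu
    have e : prodFun (List.ofFn v) (fun i => u (Fin.cast hlen i)) = ∏ i, v i (u i) := by
      rw [prodFun_eq_prod]
      exact Fintype.prod_equiv (finCongr hlen) _ _ fun i => by simp; rfl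
    rw [e, Finset.prod_congr rfl fun i _ => hu i]
    by_cases hus : u ∈ univ.pi s
    · rw [indicator_of_mem hus]
      exact Finset.prod_eq_one fun i _ => indicator_of_mem (hus i (mem_univ i)) _
    · rw [indicator_of_notMem hus]
      simp only [mem_pi, mem_univ, true_imp_iff, not_forall] at hus
      obtain ⟨i, hi⟩ := hus
      exact Finset.prod_eq_zero (Finset.mem_univ i) (indicator_of_notMem hi _)

/-- A vector orthogonal to all real pure tensors has zero integral over every box with sides of
finite measure, hence vanishes. -/
theorem span_realPure_dense (n : ℕ) :
    (Submodule.span ℂ (realPure n)).topologicalClosure = ⊤ := by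
  rw [Submodule.topologicalClosure_eq_top_iff, Submodule.eq_bot_iff]
  intro φ hφ
  refine eq_zero_of_forall_box φ fun s hs hs' => ?_
  obtain ⟨f, hf, hfe⟩ := exists_realPure_eq_indicator s hs hs'
  have h1 := (Submodule.mem_orthogonal _ _).1 hφ f (Submodule.subset_span hf)
  rw [L2.inner_def] at h1
  rw [← h1, ← integral_indicator (MeasurableSet.univ_pi hs)]
  refine integral_congr_ae ?_
  filter_upwards [hfe] with u hu
  rw [hu]
  by_cases hus : u ∈ univ.pi s <;> simp [hus]

/-- An induction principle: a closed linear property of kernels in `H^{⊗ n}` holds if it holds for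
pure tensors with real factors. -/
theorem realPure_induction {n : ℕ} {p : Particle n → Prop} (hpure : ∀ f ∈ realPure n, p f)
    (hadd : ∀ f g : Particle n, p f → p g → p (f + g))
    (hsmul : ∀ (c : ℂ) (f : Particle n), p f → p (c • f))
    (hclosed : IsClosed {f : Particle n | p f}) (f : Particle n) : p f := by
  -- The span contains 0, so `p 0` is needed; scaling any real pure tensor by 0 provides it, and the
  -- one for empty sides serves.
  have h0 : p 0 := by
    obtain ⟨f, hf, -⟩ := exists_realPure_eq_indicator (n := n) (fun _ => ∅) (by simp) (by simp)
    simpa using hsmul 0 f (hpure f hf)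
  have hspan : ∀ f ∈ Submodule.span ℂ (realPure n), p f := fun f hf =>
    Submodule.span_induction (fun f hf => hpure f hf) h0 (fun f g _ _ => hadd f g)
      (fun c f _ => hsmul c f) hf
  have hf : f ∈ closure (Submodule.span ℂ (realPure n) : Set (Particle n)) := by
    rw [← Submodule.topologicalClosure_coe, span_realPure_dense]
    trivial
  exact hclosed.closure_subset_iff.2 hspan hf

/-- An induction principle: a closed linear property of kernels holds if it holds for pure tensors
with real factors. -/
theorem particle_induction {p : ∀ n : ℕ, Particle n → Prop}
    (hpure : ∀ l, IsReal l → p l.length (purePart l))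
    (hadd : ∀ n (f g : Particle n), p n f → p n g → p n (f + g))
    (hsmul : ∀ n (c : ℂ) (f : Particle n), p n f → p n (c • f))
    (hclosed : ∀ n, IsClosed {f : Particle n | p n f}) (n : ℕ) (f : Particle n) : p n f := by
  refine realPure_induction ?_ (hadd n) (hsmul n) (hclosed n) f
  rintro f ⟨l, hl, rfl, h⟩
  rw [incl_injective h]
  exact hpure l hl

/-- Two continuous linear maps on the Fock space agree if they agree on pure tensors with real
factors. -/
theorem clm_ext_pureTensor {S T : Fock →L[ℂ] Fock}
    (h : ∀ l, IsReal l → S (pureTensor l) = T (pureTensor l)) : S = T := by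
  have h1 : ∀ (n : ℕ) (f : Particle n), S (inclL n f) = T (inclL n f) := by
    refine particle_induction (p := fun n f => S (inclL n f) = T (inclL n f)) (fun l hl => h l hl)
      (fun n f g hf hg => by simp only [map_add, hf, hg])
      (fun n c f hf => by simp only [map_smul, hf]) fun n => ?_
    exact isClosed_eq (by fun_prop) (by fun_prop)
  ext1 F
  have hF := lp.hasSum_single (p := 2) (by norm_num) F
  refine (S.hasSum hF).unique ?_
  convert T.hasSum hF using 1
  funext n
  exact h1 n (F n)

/-! ### The conjugation of the Fock space -/

theorem coeFn_adj {n : ℕ} (f : Particle n) :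
    adj f =ᵐ[cube n] fun u => (starRingEnd ℂ) (f fun i => u i.rev) := by
  filter_upwards [Lp.coeFn_star (Lp.compMeasurePreserving _ (measurePreserving_rev n) f),
    Lp.coeFn_compMeasurePreserving f (measurePreserving_rev n)] with u h1 h2
  rw [adj, h1, Pi.star_apply, h2]
  rfl

theorem ae_rev {n : ℕ} {p : (Fin n → ℝ) → Prop} (hp : ∀ᵐ x ∂cube n, p x) :
    ∀ᵐ u ∂cube n, p fun i => u i.rev :=
  (measurePreserving_rev n).quasiMeasurePreserving.ae hp

theorem adj_adj {n : ℕ} (f : Particle n) : adj (adj f) = f := by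
  refine Lp.ext ?_
  filter_upwards [coeFn_adj (adj f), ae_rev (coeFn_adj f)] with u h1 h2
  rw [h1, h2]
  simp

theorem adj_add {n : ℕ} (f g : Particle n) : adj (f + g) = adj f + adj g := by
  refine Lp.ext ?_
  filter_upwards [coeFn_adj (f + g), ae_rev (Lp.coeFn_add f g), coeFn_adj f, coeFn_adj g,
    Lp.coeFn_add (adj f) (adj g)] with u h1 h2 h3 h4 h5
  rw [h1, h2, h5, Pi.add_apply, Pi.add_apply, h3, h4, map_add]

theorem adj_smul {n : ℕ} (c : ℂ) (f : Particle n) :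
    adj (c • f) = (starRingEnd ℂ) c • adj f := by
  refine Lp.ext ?_
  filter_upwards [coeFn_adj (c • f), ae_rev (Lp.coeFn_smul c f), coeFn_adj f,
    Lp.coeFn_smul ((starRingEnd ℂ) c) (adj f)] with u h1 h2 h3 h4
  rw [h1, h2, h4, Pi.smul_apply, Pi.smul_apply, h3, smul_eq_mul, smul_eq_mul, map_mul]

theorem inner_adj_adj {n : ℕ} (f g : Particle n) :
    (inner ℂ (adj f) (adj g) : ℂ) = inner ℂ g f := by
  have he : MeasurableEmbedding fun (u : Fin n → ℝ) (i : Fin n) => u i.rev :=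
    (MeasurableEquiv.ofInvolutive (fun (u : Fin n → ℝ) (i : Fin n) => u i.rev)
      (fun u => by simp) (measurePreserving_rev n).measurable).measurableEmbedding
  rw [L2.inner_def, L2.inner_def, ← (measurePreserving_rev n).integral_comp he]
  refine integral_congr_ae ?_
  filter_upwards [ae_rev (coeFn_adj f), ae_rev (coeFn_adj g)] with u h1 h2
  rw [h1, h2]
  simp [RCLike.inner_apply, mul_comm]

theorem norm_adj {n : ℕ} (f : Particle n) : ‖adj f‖ = ‖f‖ := by
  rw [norm_eq_sqrt_re_inner (𝕜 := ℂ), inner_adj_adj, ← norm_eq_sqrt_re_inner]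

theorem memℓp_adj (F : Fock) : Memℓp (fun n => adj (F n)) 2 := by
  refine memℓp_gen ?_
  simpa [norm_adj] using (lp.memℓp F).summable (by norm_num)

/-- The conjugation `(J F)ₙ = Fₙ*` of the full Fock space. -/
def conjJ : Fock →L⋆[ℂ] Fock :=
  LinearMap.mkContinuous
    { toFun := fun F => ⟨fun n => adj (F n), memℓp_adj F⟩
      map_add' := fun F G => by
        ext1
        funext n
        exact adj_add _ _
      map_smul' := fun c F => by
        ext1
        funext n
        exact adj_smul _ _ }
    1 fun F => by
      rw [one_mul]
      refine lp.norm_le_of_tsum_le (by norm_num) (norm_nonneg _) ?_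
      rw [lp.norm_rpow_eq_tsum (by norm_num)]
      simp [norm_adj]

theorem conjJ_apply (F : Fock) (n : ℕ) : (conjJ F : Fock) n = adj (F n) := rfl

theorem conjJ_conjJ (F : Fock) : conjJ (conjJ F) = F := by
  ext1
  funext n
  exact adj_adj _

theorem inner_conjJ_conjJ (F G : Fock) : (inner ℂ (conjJ F) (conjJ G) : ℂ) = inner ℂ G F := by
  rw [lp.inner_eq_tsum, lp.inner_eq_tsum]
  exact tsum_congr fun n => inner_adj_adj _ _

theorem conjJ_incl {n : ℕ} (f : Particle n) : conjJ (incl f) = incl (adj f) := by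
  ext1
  funext k
  rw [conjJ_apply]
  by_cases hk : k = n
  · subst hk
    rw [incl_apply_self, incl_apply_self]
  · rw [incl_apply_ne _ hk, incl_apply_ne _ hk]
    simpa using adj_smul 0 (0 : Particle k)

theorem conjJ_pureTensor {l : List H} (hl : IsReal l) :
    conjJ (pureTensor l) = pureTensor l.reverse := by
  rw [pureTensor, conjJ_incl, pureTensor, ← toLp_prodFun l.reverse, ← Lp.toLp_coeFn (adj (purePart l))
    (Lp.memLp _)]
  refine incl_toLp_congr List.length_reverse.symm _ _ ?_
  filter_upwards [coeFn_adj (purePart l), ae_rev (coeFn_purePart l),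
    ae_rev (ae_conj_prodFun hl)] with u h1 h2 h3
  rw [h1, h2, h3, ← prodFun_reverse]
  simp

theorem conjJ_vacuum : conjJ vacuum = vacuum :=
  conjJ_pureTensor (l := []) (by simp [IsReal])

/-- Conjugation of an operator by `J`. -/
def conjOp (T : Fock →L[ℂ] Fock) : Fock →L[ℂ] Fock := conjJ.comp (T.comp conjJ)

theorem conjOp_apply (T : Fock →L[ℂ] Fock) (F : Fock) :
    conjOp T F = conjJ (T (conjJ F)) := rfl

theorem conjOp_conjOp (T : Fock →L[ℂ] Fock) : conjOp (conjOp T) = T := by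
  ext1 F
  simp only [conjOp_apply, conjJ_conjJ]

theorem conjOp_mul (S T : Fock →L[ℂ] Fock) : conjOp (S * T) = conjOp S * conjOp T := by
  ext1 F
  simp only [conjOp_apply, mul_apply_eq_comp, conjJ_conjJ]

/-! ### Left and right fields commute -/

theorem field_pureTensor_nil (h : H) : field h (pureTensor []) = pureTensor [h] := by
  rw [field, add_apply, creation_pureTensor, pureTensor_nil,
    adjoint_creation_vacuum, add_zero]

theorem field_pureTensor_cons (h x : H) (l : List H) :
    field h (pureTensor (x :: l)) =
      pureTensor (h :: x :: l) + (inner ℂ h x : ℂ) • pureTensor l := by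
  rw [field, add_apply, creation_pureTensor, adjoint_creation_pureTensor]

theorem conjOp_field_pureTensor_nil {k : H} (hk : k ∈ realH) :
    conjOp (field k) (pureTensor []) = pureTensor [k] := by
  rw [conjOp_apply, pureTensor_nil, conjJ_vacuum, ← pureTensor_nil, field_pureTensor_nil,
    conjJ_pureTensor (by simpa [IsReal] using hk)]
  rfl

/-- Conjugation by J reverses words, so the conjugated field creates and annihilates at the right
end. -/
theorem conjOp_field_pureTensor_append {k y : H} {l : List H} (hk : k ∈ realH)
    (hl : IsReal (l ++ [y])) :
    conjOp (field k) (pureTensor (l ++ [y])) =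
      pureTensor (l ++ [y] ++ [k]) + (inner ℂ k y : ℂ) • pureTensor l := by
  have hy : y ∈ realH := hl.right.head
  have hr := hl.reverse
  rw [conjOp_apply, conjJ_pureTensor hl]
  rw [List.reverse_append, List.reverse_singleton, List.singleton_append] at hr ⊢
  rw [field_pureTensor_cons, map_add, ContinuousLinearMap.map_smulₛₗ, inner_conj_symm,
    inner_comm_of_mem_realH hy hk, conjJ_pureTensor hr.tail, conjJ_pureTensor, List.reverse_reverse]
  · simp
  · intro z hz
    rcases List.mem_cons.1 hz with rfl | hz
    · exact hk
    · exact hr z hz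

/-- One operator acts on the first letter and the other on the last, so they can interfere only on
words of length at most one. On Ω the two orders produce ⟨h, k⟩ and ⟨k, h⟩, equal because `h` and
`k` are real. -/
theorem field_mul_conjOp_field {h k : H} (hh : h ∈ realH) (hk : k ∈ realH) :
    field h * conjOp (field k) = conjOp (field k) * field h := by
  refine clm_ext_pureTensor fun l hl => ?_
  simp only [mul_apply_eq_comp]
  have e1 : ∀ (l : List H) (y : H), IsReal (l ++ [y]) → IsReal (h :: l ++ [y]) := by
    intro l y hl z hz
    rcases List.mem_cons.1 hz with rfl | hz
    · exact hh
    · exact hl z hz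
  cases l with
  | nil =>
    rw [conjOp_field_pureTensor_nil hk, field_pureTensor_nil, field_pureTensor_cons,
      show [h] = [] ++ [h] from rfl,
      conjOp_field_pureTensor_append hk (by simpa [IsReal] using hh),
      inner_comm_of_mem_realH hh hk]
    rfl
  | cons x l =>
    rcases List.eq_nil_or_concat l with rfl | ⟨l, y, rfl⟩
    · have e2 := conjOp_field_pureTensor_append (l := []) hk hl
      have e3 := conjOp_field_pureTensor_append (l := [h]) hk (e1 [] x hl)
      simp only [List.nil_append, List.cons_append] at e2 e3
      rw [e2, map_add, map_smul, field_pureTensor_cons, field_pureTensor_nil,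
        field_pureTensor_cons, map_add, map_smul, e3, conjOp_field_pureTensor_nil hk]
      abel
    · have e2 := conjOp_field_pureTensor_append (l := x :: l) (y := y) hk (by simpa using hl)
      have e3 := conjOp_field_pureTensor_append (l := h :: x :: l) (y := y) hk
        (e1 (x :: l) y (by simpa using hl))
      have e4 := conjOp_field_pureTensor_append (l := l) (y := y) hk
        (by have := hl.tail; simpa using this)
      simp only [List.concat_eq_append, List.cons_append] at e2 e3 e4 ⊢
      rw [e2, map_add, map_smul, field_pureTensor_cons, field_pureTensor_cons,
        field_pureTensor_cons, map_add, map_smul, e3, e4]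
      simp only [smul_add, smul_smul, mul_comm]
      abel

/-! ### The von Neumann algebra and its commutant -/

theorem star_field (h : H) : star (field h) = field h := by
  rw [field, star_add, ContinuousLinearMap.star_eq_adjoint, ContinuousLinearMap.star_eq_adjoint,
    ContinuousLinearMap.adjoint_adjoint, add_comm]

theorem field_mem_vonNeumann {h : H} (hh : h ∈ realH) : field h ∈ vonNeumann :=
  Set.subset_centralizer_centralizer ⟨h, hh, rfl⟩

theorem star_mem_vonNeumann {A : Fock →L[ℂ] Fock} (hA : A ∈ vonNeumann) :
    star A ∈ vonNeumann := by
  refine Set.star_mem_centralizer' (fun B hB => Set.star_mem_centralizer' ?_ hB) hA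
  rintro _ ⟨h, hh, rfl⟩
  exact ⟨h, hh, (star_field h).symm⟩

theorem mul_mem_vonNeumann {A B : Fock →L[ℂ] Fock} (hA : A ∈ vonNeumann) (hB : B ∈ vonNeumann) :
    A * B ∈ vonNeumann := Set.mul_mem_centralizer hA hB

/-- A conjugated field lies in the commutant of the fields, so `A` commutes with it; conjugating
this relation puts JAJ in the commutant of the fields, with which `B` commutes. -/
theorem conjOp_mul_comm {A B : Fock →L[ℂ] Fock} (hA : A ∈ vonNeumann) (hB : B ∈ vonNeumann) :
    conjOp A * B = B * conjOp A := by
  refine (hB (conjOp A) ?_)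
  rintro _ ⟨h, hh, rfl⟩
  have h1 : conjOp (field h) ∈ centralizer (field '' realH) := by
    rintro _ ⟨k, hk, rfl⟩
    exact field_mul_conjOp_field hk hh
  have h2 := congrArg conjOp (hA _ h1)
  rwa [conjOp_mul, conjOp_mul, conjOp_conjOp] at h2

/-! ### The operators `g ↦ f ⌢ᵖ g` on the Fock space -/

/-- The components of the image of `F` under `g ↦ f ⌢ᵖ g`. -/
def contractSeq {m : ℕ} (p : ℕ) (f : Particle m) (F : Fock) (N : ℕ) : Particle N :=
  -- Degree `N` is reached from degree n = N + 2p - m, and p ≤ n means m ≤ N + p. The guard excludes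
  -- truncated subtraction and makes `N ↦ N + 2p - m` injective where it is used.
  if m ≤ N + p then (contraction p f (F (N + 2 * p - m)) : Fock) N else 0

/-- Each output degree comes from a single input degree, and distinct outputs from distinct inputs;
the bound for one contraction therefore sums to the same bound on the Fock space. -/
theorem sum_norm_contractSeq_le {m : ℕ} (p : ℕ) (f : Particle m) (F : Fock) (s : Finset ℕ) :
    ∑ N ∈ s, ‖contractSeq p f F N‖ ^ (2 : ℝ) ≤ (‖f‖ * ‖F‖) ^ (2 : ℝ) := by
  have h2 : (0 : ℝ) < (2 : ℝ≥0∞).toReal := by norm_num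
  calc ∑ N ∈ s, ‖contractSeq p f F N‖ ^ (2 : ℝ)
      ≤ ∑ N ∈ s, if m ≤ N + p then ‖f‖ ^ (2 : ℝ) * ‖F (N + 2 * p - m)‖ ^ (2 : ℝ) else 0 := by
        refine Finset.sum_le_sum fun N _ => ?_
        rw [contractSeq]
        split_ifs
        · rw [← Real.mul_rpow (norm_nonneg _) (norm_nonneg _)]
          refine Real.rpow_le_rpow (norm_nonneg _) ?_ (by norm_num)
          exact (lp.norm_apply_le_norm (by norm_num) _ _).trans (norm_contraction_le _ _)
        · simp
    _ = ∑ N ∈ s with m ≤ N + p, ‖f‖ ^ (2 : ℝ) * ‖F (N + 2 * p - m)‖ ^ (2 : ℝ) :=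
        (Finset.sum_filter _ _).symm
    _ = ∑ k ∈ (s.filter fun N => m ≤ N + p).image fun N => N + 2 * p - m,
          ‖f‖ ^ (2 : ℝ) * ‖F k‖ ^ (2 : ℝ) := by
        refine (Finset.sum_image (f := fun k => ‖f‖ ^ (2 : ℝ) * ‖F k‖ ^ (2 : ℝ)) ?_).symm
        intro N hN N' hN' h
        simp only [Finset.coe_filter, mem_ofPred_eq] at hN hN' h
        omega
    _ ≤ (‖f‖ * ‖F‖) ^ (2 : ℝ) := by
        rw [← Finset.mul_sum, Real.mul_rpow (norm_nonneg _) (norm_nonneg _)]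
        have := lp.sum_rpow_le_norm_rpow h2 F
          ((s.filter fun N => m ≤ N + p).image fun N => N + 2 * p - m)
        simp only [ENNReal.toReal_ofNat] at this
        gcongr

theorem memℓp_contractSeq {m : ℕ} (p : ℕ) (f : Particle m) (F : Fock) :
    Memℓp (contractSeq p f F) 2 :=
  memℓp_gen' (C := (‖f‖ * ‖F‖) ^ (2 : ℝ)) fun s => by
    simpa using sum_norm_contractSeq_le p f F s

/-- The operator `g ↦ f ⌢ᵖ g` on the full Fock space. -/
def contractOp {m : ℕ} (p : ℕ) (f : Particle m) : Fock →L[ℂ] Fock :=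
  LinearMap.mkContinuous
    { toFun := fun F => ⟨contractSeq p f F, memℓp_contractSeq p f F⟩
      map_add' := fun F G => by
        ext1
        funext N
        change contractSeq p f (F + G) N = contractSeq p f F N + contractSeq p f G N
        simp only [contractSeq, ← contractionL_apply]
        split_ifs
        · rw [lp.coeFn_add, Pi.add_apply, map_add]
          rfl
        · rw [add_zero]
      map_smul' := fun c F => by
        ext1
        funext N
        change contractSeq p f (c • F) N = c • contractSeq p f F N
        simp only [contractSeq, ← contractionL_apply]
        split_ifs
        · rw [lp.coeFn_smul, Pi.smul_apply, map_smul]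
          rfl
        · rw [smul_zero] }
    ‖f‖ fun F => lp.norm_le_of_forall_sum_le (by norm_num) (by positivity) fun s => by
      simpa using sum_norm_contractSeq_le p f F s

theorem contractOp_apply {m : ℕ} (p : ℕ) (f : Particle m) (F : Fock) (N : ℕ) :
    (contractOp p f F : Fock) N = contractSeq p f F N := rfl

theorem contraction_apply_ne {m n p N : ℕ} (f : Particle m) (g : Particle n)
    (h : N + 2 * p ≠ m + n) : (contraction p f g : Fock) N = 0 := by
  by_cases hp : p ≤ m ∧ p ≤ n
  · obtain ⟨⟨a, rfl⟩, ⟨b, rfl⟩⟩ := And.imp Nat.exists_eq_add_of_le' Nat.exists_eq_add_of_le hp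
    rw [contraction_eq_incl, incl_apply_ne _ (by omega)]
  · rw [contraction_of_not_le hp]
    rfl

theorem contractOp_incl {m n : ℕ} (p : ℕ) (f : Particle m) (g : Particle n) :
    contractOp p f (incl g) = contraction p f g := by
  ext1
  funext N
  rw [contractOp_apply, contractSeq]
  by_cases hp : p ≤ m ∧ p ≤ n
  swap
  · rw [contraction_of_not_le hp]
    split_ifs with h
    · by_cases hk : N + 2 * p - m = n
      · subst hk
        rw [incl_apply_self, contraction_of_not_le hp]
      · rw [incl_apply_ne _ hk, ← contractionL_apply, map_zero]
    · rfl
  split_ifs with h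
  · by_cases hk : N + 2 * p - m = n
    · subst hk
      rw [incl_apply_self]
    · rw [incl_apply_ne _ hk, ← contractionL_apply, map_zero,
        contraction_apply_ne _ _ (by omega)]
      rfl
  · rw [contraction_apply_ne _ _ (by omega)]

theorem norm_contractOp_le {m : ℕ} (p : ℕ) (f : Particle m) : ‖contractOp p f‖ ≤ ‖f‖ := by
  rw [contractOp]
  exact LinearMap.mkContinuous_norm_le _ (norm_nonneg _) _

/-- The map `f ↦ (g ↦ f ⌢ᵖ g)` as a continuous linear map. -/
def contractOpL (m p : ℕ) : Particle m →L[ℂ] Fock →L[ℂ] Fock :=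
  LinearMap.mkContinuous
    { toFun := contractOp p
      map_add' := fun f g => by
        ext F : 3
        change contractSeq p (f + g) F _ = contractSeq p f F _ + contractSeq p g F _
        simp only [contractSeq, ← contractionL_apply]
        split_ifs
        · rw [map_add]
          rfl
        · rw [add_zero]
      map_smul' := fun c f => by
        ext F : 3
        change contractSeq p (c • f) F _ = c • contractSeq p f F _
        simp only [contractSeq, ← contractionL_apply]
        split_ifs
        · rw [map_smul]
          rfl
        · rw [smul_zero] }
    1 fun f => by
      rw [one_mul]
      exact norm_contractOp_le p f

/-! ### The free Wigner integral -/

/-- The free Wigner integral as a continuous linear map. -/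
def wignerL (m : ℕ) : Particle m →L[ℂ] Fock →L[ℂ] Fock :=
  ∑ p ∈ Finset.range (m + 1), contractOpL m p

theorem wignerL_incl {m n : ℕ} (f : Particle m) (g : Particle n) :
    wignerL m f (incl g) = ∑ p ∈ Finset.range (m + 1), contraction p f g := by
  simp only [wignerL, sum_apply]
  exact Finset.sum_congr rfl fun p _ => contractOp_incl p f g

theorem exists_append_length_right {l : List H} {p : ℕ} (hp : p ≤ l.length) :
    ∃ A B, l = A ++ B ∧ B.length = p :=
  ⟨l.take (l.length - p), l.drop (l.length - p), (List.take_append_drop _ _).symm, by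
    rw [List.length_drop]; omega⟩

theorem exists_append_length_left {l : List H} {p : ℕ} (hp : p ≤ l.length) :
    ∃ C D, l = C ++ D ∧ C.length = p :=
  ⟨l.take p, l.drop p, (List.take_append_drop _ _).symm, by
    rw [List.length_take]; omega⟩

theorem exists_reverse_append_length {l : List H} {p : ℕ} (hp : p ≤ l.length) :
    ∃ C D : List H, l = C.reverse ++ D ∧ p = C.length := by
  obtain ⟨C, D, rfl, rfl⟩ := exists_append_length_left hp
  exact ⟨C.reverse, D, by simp, by simp⟩

/-- The first letter of the left factor is not contracted when `p` is at most the length of the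
tail, so it only gets prepended. -/
theorem contraction_purePart_cons {h : H} {l l' : List H} (hl : IsReal l) {p : ℕ}
    (hp : p ≤ l.length) :
    contraction p (purePart (h :: l)) (purePart l') =
      creation h (contraction p (purePart l) (purePart l')) := by
  by_cases hp' : p ≤ l'.length
  · obtain ⟨A, B, rfl, rfl⟩ := exists_append_length_right hp
    obtain ⟨C, D, rfl, hC⟩ := exists_reverse_append_length hp'
    rw [contraction_purePart hC hl.right, map_smul, creation_pureTensor]
    exact contraction_purePart (A := h :: A) hC hl.right
  · rw [contraction_of_not_le (by tauto), contraction_of_not_le (by tauto), map_zero]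

/-- Once `l` is fully contracted, the next letter of `l'` stands first and annihilation pairs it
with `h`. If no letter is left, the result is a multiple of Ω and is annihilated. -/
theorem contraction_purePart_length_succ {h : H} {l l' : List H} (hl : IsReal (h :: l)) :
    contraction (l.length + 1) (purePart (h :: l)) (purePart l') =
      ContinuousLinearMap.adjoint (creation h)
        (contraction l.length (purePart l) (purePart l')) := by
  by_cases hp : l.length + 1 ≤ l'.length
  · obtain ⟨C, D, rfl, hC⟩ := exists_reverse_append_length hp
    cases C with
    | nil => simp at hC
    | cons x C =>
      have e1 := contraction_purePart (A := []) (B := h :: l) (C := x :: C) (D := D) hC hl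
      have e2 := contraction_purePart_of_eq (A := []) (B := l) (C := C) (D := x :: D) rfl
        (show (x :: C).reverse ++ D = _ by simp) rfl (by simpa using hC) hl.tail
      simp only [List.nil_append, listInner] at e1 e2
      rw [e2, map_smul, adjoint_creation_pureTensor, smul_smul, mul_comm]
      exact e1
  · rw [contraction_of_not_le (by tauto)]
    by_cases hp' : l.length ≤ l'.length
    · obtain ⟨C, D, rfl, hC⟩ := exists_reverse_append_length hp'
      have hD : D = [] := by
        rw [← List.length_eq_zero_iff]
        rw [List.length_append, List.length_reverse] at hp
        omega
      subst hD
      have e2 := contraction_purePart (A := []) (B := l) (C := C) (D := []) hC hl.tail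
      simp only [List.nil_append] at e2
      rw [e2, pureTensor_nil, map_smul, adjoint_creation_vacuum, smul_zero]
    · rw [contraction_of_not_le (by tauto), map_zero]

theorem adjoint_creation_contraction_purePart {h x : H} {t l' : List H} (hl : IsReal t) {p : ℕ}
    (hp : p ≤ t.length) :
    ContinuousLinearMap.adjoint (creation h)
        (contraction p (purePart (x :: t)) (purePart l')) =
      (inner ℂ h x : ℂ) • contraction p (purePart t) (purePart l') := by
  by_cases hp' : p ≤ l'.length
  · obtain ⟨A, B, rfl, rfl⟩ := exists_append_length_right hp
    obtain ⟨C, D, rfl, hC⟩ := exists_reverse_append_length hp'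
    have e1 := contraction_purePart (A := x :: A) (D := D) hC hl.right
    rw [List.cons_append] at e1
    rw [e1, contraction_purePart hC hl.right, map_smul, List.cons_append,
      adjoint_creation_pureTensor, smul_comm]
  · rw [contraction_of_not_le (by tauto), contraction_of_not_le (by tauto), map_zero, smul_zero]

theorem wignerL_purePart_nil : wignerL 0 (purePart []) = 1 := by
  refine clm_ext_pureTensor fun l _ => ?_
  rw [pureTensor, wignerL_incl, Finset.sum_range_one]
  have := contraction_purePart (A := []) (B := []) (C := []) (D := l) rfl (by simp [IsReal])
  simp only [listInner, one_smul] at this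
  exact this

theorem wignerL_purePart_singleton {h : H} (hh : h ∈ realH) :
    wignerL 1 (purePart [h]) = field h := by
  have hr : IsReal [h] := by simpa [IsReal] using hh
  refine clm_ext_pureTensor fun l _ => ?_
  have e := congrArg (fun T : Fock →L[ℂ] Fock => T (pureTensor l)) wignerL_purePart_nil
  simp only [pureTensor, wignerL_incl, zero_add, Finset.sum_range_one] at e
  rw [pureTensor, wignerL_incl, Finset.sum_range_succ, Finset.sum_range_one]
  have e1 := contraction_purePart_cons (h := h) (l' := l) hr.tail (Nat.zero_le _)
  have e2 := contraction_purePart_length_succ (l' := l) hr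
  simp only [List.length_nil, zero_add] at e1 e2
  rw [field, add_apply]
  refine (congrArg₂ (· + ·) e1 e2).trans ?_
  erw [e]
  rfl

/-- Creation by `h` yields every contraction of `h :: x :: t` except the complete one. Annihilation
yields that one from the complete contraction of `x :: t`; from the lower ones it removes `x`,
producing ⟨h, x⟩ times the integral of `t`, the term subtracted. -/
theorem wignerL_purePart_cons_cons {h x : H} {t : List H} (hl : IsReal (h :: x :: t)) :
    wignerL _ (purePart (h :: x :: t)) =
      field h * wignerL _ (purePart (x :: t)) -
        (inner ℂ h x : ℂ) • wignerL _ (purePart t) := by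
  refine clm_ext_pureTensor fun l _ => ?_
  rw [sub_apply, smul_apply, mul_apply_eq_comp,
    pureTensor, wignerL_incl, wignerL_incl, wignerL_incl, eq_sub_iff_add_eq, field, add_apply,
    map_sum, map_sum]
  change ∑ p ∈ Finset.range (t.length + 1 + 1 + 1), _ + _ = _ +
    ∑ p ∈ Finset.range (t.length + 1 + 1), _
  -- The complete contraction is split off on both sides, since it is the only one in which `h`
  -- itself is contracted.
  rw [Finset.sum_range_succ _ (t.length + 1 + 1), Finset.sum_range_succ
    (fun p => ContinuousLinearMap.adjoint (creation h)
      (contraction p (purePart (x :: t)) (purePart l))), Finset.smul_sum,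
    add_comm (∑ p ∈ Finset.range (t.length + 1), ContinuousLinearMap.adjoint (creation h) _),
    ← add_assoc]
  congr 1
  · congr 1
    · exact Finset.sum_congr rfl fun p hp =>
        contraction_purePart_cons hl.tail (by simpa [Nat.lt_succ_iff] using hp)
    · exact contraction_purePart_length_succ hl
  · exact Finset.sum_congr rfl fun p hp =>
      (adjoint_creation_contraction_purePart hl.tail.tail
        (by simpa [Nat.lt_succ_iff] using hp)).symm

theorem one_mem_vonNeumann : (1 : Fock →L[ℂ] Fock) ∈ vonNeumann := Set.one_mem_centralizer

theorem add_mem_vonNeumann {A B : Fock →L[ℂ] Fock} (hA : A ∈ vonNeumann) (hB : B ∈ vonNeumann) :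
    A + B ∈ vonNeumann := Set.add_mem_centralizer hA hB

theorem smul_mem_vonNeumann (c : ℂ) {A : Fock →L[ℂ] Fock} (hA : A ∈ vonNeumann) :
    c • A ∈ vonNeumann := fun B hB => by
  rw [mul_smul_comm, smul_mul_assoc, hA B hB]

theorem wignerL_purePart_mem : ∀ {l : List H}, IsReal l →
    wignerL l.length (purePart l) ∈ vonNeumann
  | [], _ => by
    have := one_mem_vonNeumann
    rwa [← wignerL_purePart_nil] at this
  | [h], hl => by
    have := field_mem_vonNeumann hl.head
    rwa [← wignerL_purePart_singleton hl.head] at this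
  | h :: x :: t, hl => by
    rw [wignerL_purePart_cons_cons hl, sub_eq_add_neg, ← neg_smul]
    exact add_mem_vonNeumann
      (mul_mem_vonNeumann (field_mem_vonNeumann hl.head) (wignerL_purePart_mem hl.tail))
      (smul_mem_vonNeumann _ (wignerL_purePart_mem hl.tail.tail))

/-- A centralizer is norm closed and `wignerL` is continuous from the L² norm to the operator norm,
so the case of real pure tensors suffices. -/
theorem wignerL_mem {m : ℕ} (f : Particle m) : wignerL m f ∈ vonNeumann := by
  refine particle_induction (p := fun m f => wignerL m f ∈ vonNeumann)
    (fun l hl => wignerL_purePart_mem hl) (fun n f g hf hg => ?_) (fun n c f hf => ?_)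
    (fun n => ?_) m f
  · rw [map_add]
    exact add_mem_vonNeumann hf hg
  · rw [map_smul]
    exact smul_mem_vonNeumann c hf
  · exact (Set.isClosed_centralizer _).preimage (wignerL n).continuous

theorem contraction_zero_vacuum {m : ℕ} (f : Particle m) :
    contraction 0 f (purePart []) = incl f := by
  refine particle_induction (p := fun m f => contractionL m 0 0 f (purePart []) = inclL m f)
    (fun l hl => ?_) (fun n f g hf hg => ?_) (fun n c f hf => ?_) (fun n => ?_) m f
  · have := contraction_purePart_of_eq (A := l) (B := []) (C := []) (D := [])
      (List.append_nil l).symm rfl rfl rfl (by simp [IsReal])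
    rw [List.append_nil l, listInner, one_smul] at this
    · exact this
    · simp
  · rw [map_add, add_apply, hf, hg, map_add]
  · rw [map_smul, smul_apply, hf, map_smul]
  · exact isClosed_eq (by fun_prop) (by fun_prop)

theorem wignerL_vacuum {m : ℕ} (f : Particle m) : wignerL m f vacuum = incl f := by
  rw [← pureTensor_nil, pureTensor, wignerL_incl, Finset.sum_eq_single 0,
    contraction_zero_vacuum]
  · intro p _ hp
    exact contraction_of_not_le (by simpa using fun _ => hp) _ _
  · simp

/-! ### The vacuum is separating and tracial -/

theorem incl_eq_conjOp_vacuum {n : ℕ} (g : Particle n) :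
    incl g = conjOp (wignerL n (adj g)) vacuum := by
  rw [conjOp_apply, conjJ_vacuum, wignerL_vacuum, conjJ_incl, adj_adj]

/-- Write `incl g` as RΩ with R conjugate to an element of Γ₀. Then C(RΩ) = R(CΩ) for C in Γ₀, so C
is determined by CΩ. -/
theorem eq_of_vacuum_eq {A B : Fock →L[ℂ] Fock} (hA : A ∈ vonNeumann) (hB : B ∈ vonNeumann)
    (h : A vacuum = B vacuum) : A = B := by
  have key : ∀ {C : Fock →L[ℂ] Fock}, C ∈ vonNeumann → ∀ {n : ℕ} (g : Particle n),
      C (incl g) = conjOp (wignerL n (adj g)) (C vacuum) := by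
    intro C hC n g
    rw [incl_eq_conjOp_vacuum, ← mul_apply_eq_comp, ← mul_apply_eq_comp,
      conjOp_mul_comm (wignerL_mem _) hC]
  refine clm_ext_pureTensor fun l _ => ?_
  rw [pureTensor, key hA, key hB, h]

theorem existsUnique_isWignerIntegral {n : ℕ} (f : Particle n) :
    ∃! A, IsWignerIntegral f A :=
  ⟨wignerL n f, ⟨wignerL_mem f, wignerL_vacuum f⟩, fun _ hA =>
    eq_of_vacuum_eq hA.1 (wignerL_mem f) (hA.2.trans (wignerL_vacuum f).symm)⟩

theorem wignerIntegral_eq {n : ℕ} (f : Particle n) : wignerIntegral f = wignerL n f := by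
  have h : ∃ X, IsWignerIntegral f X := (existsUnique_isWignerIntegral f).exists
  rw [wignerIntegral, dif_pos h]
  exact (existsUnique_isWignerIntegral f).unique h.choose_spec
    ⟨wignerL_mem f, wignerL_vacuum f⟩

theorem inner_vacuum_vacuum : (inner ℂ vacuum vacuum : ℂ) = 1 :=
  inner_pureTensor (l := []) (l' := []) rfl

theorem contraction_self_purePart {l l' : List H} (hl : IsReal l) (h : l.length = l'.length) :
    contraction l.length (purePart l) (purePart l') =
      (inner ℂ (conjJ (pureTensor l)) (pureTensor l') : ℂ) • vacuum := by
  rw [contraction_purePart_of_eq (A := []) (B := l) (C := l'.reverse) (D := [])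
    (List.nil_append l).symm (by simp) rfl (by simpa using h) hl, conjJ_pureTensor hl, inner_pureTensor (by simpa using h),
    ← listInner_reverse (by simpa using h), List.reverse_reverse]
  rfl

/-- Contraction of all variables gives the inner product. -/
theorem contraction_self {n : ℕ} (f g : Particle n) :
    contraction n f g = (inner ℂ (conjJ (incl f)) (incl g) : ℂ) • vacuum := by
  -- Keeping the two degrees separate, with their equality as a hypothesis, allows the induction on
  -- pure tensors in each variable independently.
  have key : ∀ (m : ℕ) (f : Particle m) (n : ℕ) (g : Particle n), m = n →
      contractionL m n m f g = (inner ℂ (conjJ (inclL m f)) (inclL n g) : ℂ) • vacuum := by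
    refine particle_induction (fun l hl => ?_) (fun n f f' hf hf' k g h => ?_)
      (fun n c f hf k g h => ?_) (fun n => ?_)
    · refine particle_induction (fun l' hl' h => ?_) (fun n g g' hg hg' h => ?_)
        (fun n c g hg h => ?_) (fun n => ?_)
      · exact contraction_self_purePart hl h
      · rw [map_add, hg h, hg' h, map_add, inner_add_right, add_smul]
      · rw [map_smul, hg h, map_smul, inner_smul_right, mul_smul]
      · simp only [Set.ofPred_forall]
        exact isClosed_iInter fun _ => isClosed_eq (by fun_prop) (by fun_prop)
    · rw [map_add, add_apply, hf k g h, hf' k g h, map_add, map_add, inner_add_left, add_smul]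
    · rw [map_smul, smul_apply, hf k g h, map_smul, ContinuousLinearMap.map_smulₛₗ,
        inner_smul_left, Complex.conj_conj, mul_smul]
    · simp only [Set.ofPred_forall]
      exact isClosed_iInter fun _ => isClosed_iInter fun _ => isClosed_iInter fun _ =>
        isClosed_eq (by fun_prop) (by fun_prop)
  exact key n f n g rfl

theorem inner_vacuum_contraction {m n p : ℕ} (f : Particle m) (g : Particle n)
    (h : 2 * p ≠ m + n) : (inner ℂ vacuum (contraction p f g) : ℂ) = 0 := by
  rw [vacuum, inner_incl_left, contraction_apply_ne _ _ (by simpa using h), inner_zero_right]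

/-- Only a contraction exhausting both kernels has a vacuum component, which forces `m = n = p`. -/
theorem inner_vacuum_wignerL_incl {m n : ℕ} (f : Particle m) (g : Particle n) :
    (inner ℂ vacuum (wignerL m f (incl g)) : ℂ) = inner ℂ (conjJ (incl f)) (incl g) := by
  rw [wignerL_incl, inner_sum]
  by_cases h : m = n
  · subst h
    rw [Finset.sum_range_succ, Finset.sum_eq_zero, contraction_self, inner_smul_right,
      inner_vacuum_vacuum, mul_one, zero_add]
    intro p hp
    rw [Finset.mem_range] at hp
    exact inner_vacuum_contraction _ _ (by omega)
  · rw [conjJ_incl, inner_incl_of_ne h]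
    refine Finset.sum_eq_zero fun p _ => ?_
    by_cases hp : 2 * p = m + n
    · rw [contraction_of_not_le (by omega), inner_zero_right]
    · exact inner_vacuum_contraction _ _ hp

theorem ext_inner_incl {F G : Fock}
    (h : ∀ (n : ℕ) (g : Particle n), (inner ℂ F (incl g) : ℂ) = inner ℂ G (incl g)) : F = G := by
  ext1
  funext n
  refine ext_inner_right ℂ fun g => ?_
  rw [← inner_incl_right, h, inner_incl_right]

theorem inner_star_apply (A : Fock →L[ℂ] Fock) (F G : Fock) :
    (inner ℂ (star A F) G : ℂ) = inner ℂ F (A G) :=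
  ContinuousLinearMap.adjoint_inner_left A G F

theorem star_wignerL_vacuum {m : ℕ} (f : Particle m) :
    star (wignerL m f) vacuum = conjJ (incl f) :=
  ext_inner_incl fun n g => by rw [inner_star_apply, inner_vacuum_wignerL_incl]

theorem star_wignerL {m : ℕ} (f : Particle m) : star (wignerL m f) = wignerL m (adj f) :=
  eq_of_vacuum_eq (star_mem_vonNeumann (wignerL_mem f)) (wignerL_mem _) (by
    rw [star_wignerL_vacuum, wignerL_vacuum, conjJ_incl])

/-- Test against g = RΩ with R = J I₀(g*) J. Since R commutes with `A`, ⟨A*Ω, g⟩ = ⟨Ω, RAΩ⟩;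
antiunitarity of J and the known adjoint of a Wigner integral on Ω turn this into ⟨JAΩ, g⟩. -/
theorem star_vacuum {A : Fock →L[ℂ] Fock} (hA : A ∈ vonNeumann) :
    star A vacuum = conjJ (A vacuum) := by
  refine ext_inner_incl fun n g => ?_
  have h1 : (inner ℂ (star A vacuum) (incl g) : ℂ) =
      inner ℂ vacuum (conjOp (wignerL n (adj g)) (A vacuum)) := by
    rw [inner_star_apply, incl_eq_conjOp_vacuum, ← mul_apply_eq_comp, ← mul_apply_eq_comp,
      conjOp_mul_comm (wignerL_mem _) hA]
  rw [h1, conjOp_apply, ← inner_conjJ_conjJ, conjJ_conjJ, conjJ_vacuum,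
    ← inner_conj_symm, ← inner_star_apply, star_wignerL_vacuum, conjJ_incl, adj_adj,
    inner_conj_symm]

theorem trace_mul (A B : Fock →L[ℂ] Fock) :
    trace (A * B) = inner ℂ (star A vacuum) (B vacuum) := by
  rw [trace, inner_star_apply, mul_apply_eq_comp]

/-- The vacuum state is a trace on the von Neumann algebra. -/
theorem trace_mul_comm {A B : Fock →L[ℂ] Fock} (hA : A ∈ vonNeumann) (hB : B ∈ vonNeumann) :
    trace (A * B) = trace (B * A) := by
  rw [trace_mul, trace_mul, star_vacuum hA, star_vacuum hB, ← inner_conjJ_conjJ, conjJ_conjJ]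

/-! ### Identities between contractions -/

theorem incl_adj_purePart {l : List H} (hl : IsReal l) :
    incl (adj (purePart l)) = incl (purePart l.reverse) := by
  rw [← conjJ_incl]
  exact conjJ_pureTensor hl

/-- The map `f ↦ f*` as a continuous conjugate-linear map. -/
def adjL (n : ℕ) : Particle n →L⋆[ℂ] Particle n :=
  LinearMap.mkContinuous { toFun := adj, map_add' := adj_add, map_smul' := adj_smul } 1
    fun f => by rw [one_mul]; exact (norm_adj f).le

theorem adjL_apply {n : ℕ} (f : Particle n) : adjL n f = adj f := rfl

theorem conjJ_contraction_purePart {p : ℕ} {l l' : List H} (hl : IsReal l) (hl' : IsReal l') :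
    conjJ (contraction p (purePart l) (purePart l')) =
      contraction p (adj (purePart l')) (adj (purePart l)) := by
  by_cases h : p ≤ l.length ∧ p ≤ l'.length
  · rw [contraction_congr p (List.length_reverse (as := l')).symm
      (List.length_reverse (as := l)).symm (incl_adj_purePart hl') (incl_adj_purePart hl)]
    obtain ⟨A, B, rfl, rfl⟩ := exists_append_length_right h.1
    obtain ⟨C, D, rfl, hC⟩ := exists_reverse_append_length h.2
    have hAD : IsReal (A ++ D) := fun z hz => (List.mem_append.1 hz).elim (hl.left z) (hl'.right z)
    have hCr : IsReal C := by simpa using hl'.left.reverse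
    rw [contraction_purePart hC hl.right, ContinuousLinearMap.map_smulₛₗ, conj_listInner,
      conjJ_pureTensor hAD,
      contraction_purePart_of_eq (A := D.reverse) (B := C) (C := B) (D := A.reverse)
        (by simp) (by simp) hC hC.symm hCr, List.reverse_append]
  · rw [contraction_of_not_le h, contraction_of_not_le (by tauto), map_zero]

theorem conjJ_contraction {m n : ℕ} (p : ℕ) (f : Particle m) (g : Particle n) :
    conjJ (contraction p f g) = contraction p (adj g) (adj f) := by
  have key : ∀ (m : ℕ) (f : Particle m) (n : ℕ) (g : Particle n),
      conjJ (contractionL m n p f g) = contractionL n m p (adjL n g) (adjL m f) := by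
    refine particle_induction (fun l hl => ?_) (fun n f f' hf hf' k g => ?_)
      (fun n c f hf k g => ?_) (fun n => ?_)
    · refine particle_induction (fun l' hl' => ?_) (fun n g g' hg hg' => ?_)
        (fun n c g hg => ?_) (fun n => ?_)
      · exact conjJ_contraction_purePart hl hl'
      · rw [map_add, map_add, hg, hg', map_add, map_add, add_apply]
      · rw [map_smul, ContinuousLinearMap.map_smulₛₗ, hg, ContinuousLinearMap.map_smulₛₗ,
          map_smul, smul_apply]
      · exact isClosed_eq (by fun_prop) (by fun_prop)
    · rw [map_add, add_apply, map_add, hf, hf', map_add, map_add]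
    · rw [map_smul, smul_apply, ContinuousLinearMap.map_smulₛₗ, hf,
        ContinuousLinearMap.map_smulₛₗ, map_smul]
    · simp only [Set.ofPred_forall]
      exact isClosed_iInter fun _ => isClosed_iInter fun _ =>
        isClosed_eq (by fun_prop) (by fun_prop)
  exact key m f n g

theorem contraction_zero_purePart (l l' : List H) :
    contraction 0 (purePart l) (purePart l') = pureTensor (l ++ l') := by
  rw [contraction_purePart_of_eq (p := 0) (A := l) (B := []) (C := []) (D := l')
    (List.append_nil l).symm (List.nil_append l').symm rfl rfl (by simp [IsReal]), listInner,
    one_smul]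
  simp

theorem inner_contraction_zero_pure {m n : ℕ} {f₁ f₂ : Particle m} {g₁ g₂ : Particle n}
    (hf₁ : f₁ ∈ realPure m) (hf₂ : f₂ ∈ realPure m) (hg₁ : g₁ ∈ realPure n)
    (hg₂ : g₂ ∈ realPure n) :
    (inner ℂ (contraction 0 f₁ g₁) (contraction 0 f₂ g₂) : ℂ) =
      inner ℂ f₁ f₂ * inner ℂ g₁ g₂ := by
  obtain ⟨a₁, -, ha₁, hf₁⟩ := hf₁
  obtain ⟨a₂, -, ha₂, hf₂⟩ := hf₂
  obtain ⟨b₁, -, hb₁, hg₁⟩ := hg₁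
  obtain ⟨b₂, -, hb₂, hg₂⟩ := hg₂
  rw [contraction_congr 0 ha₁.symm hb₁.symm hf₁ hg₁, contraction_congr 0 ha₂.symm hb₂.symm hf₂ hg₂,
    contraction_zero_purePart, contraction_zero_purePart, ← inner_incl_incl, ← inner_incl_incl,
    hf₁, hf₂, hg₁, hg₂, inner_pureTensor (ha₁.trans ha₂.symm),
    inner_pureTensor (hb₁.trans hb₂.symm), inner_pureTensor (by simp [ha₁, ha₂, hb₁, hb₂]),
    listInner_append (ha₁.trans ha₂.symm)]

theorem inner_contraction_zero {m n : ℕ} (f₁ f₂ : Particle m) (g₁ g₂ : Particle n) :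
    (inner ℂ (contraction 0 f₁ g₁) (contraction 0 f₂ g₂) : ℂ) =
      inner ℂ f₁ f₂ * inner ℂ g₁ g₂ := by
  simp only [← contractionL_apply]
  induction f₁ using realPure_induction with
  | hadd f f' hf hf' => simp only [map_add, add_apply, inner_add_left, hf, hf', add_mul]
  | hsmul c f hf => simp only [map_smul, smul_apply, inner_smul_left, hf, mul_assoc]
  | hclosed => exact isClosed_eq (by fun_prop) (by fun_prop)
  | hpure f₁ hf₁ =>
  induction f₂ using realPure_induction with
  | hadd f f' hf hf' => simp only [map_add, add_apply, inner_add_right, hf, hf', add_mul]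
  | hsmul c f hf => simp only [map_smul, smul_apply, inner_smul_right, hf, mul_assoc]
  | hclosed => exact isClosed_eq (by fun_prop) (by fun_prop)
  | hpure f₂ hf₂ =>
  induction g₁ using realPure_induction with
  | hadd f f' hf hf' => simp only [map_add, inner_add_left, hf, hf', mul_add]
  | hsmul c f hf => simp only [map_smul, inner_smul_left, hf, mul_left_comm]
  | hclosed => exact isClosed_eq (by fun_prop) (by fun_prop)
  | hpure g₁ hg₁ =>
  induction g₂ using realPure_induction with
  | hadd f f' hf hf' => simp only [map_add, inner_add_right, hf, hf', mul_add]
  | hsmul c f hf => simp only [map_smul, inner_smul_right, hf, mul_left_comm]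
  | hclosed => exact isClosed_eq (by fun_prop) (by fun_prop)
  | hpure g₂ hg₂ => exact inner_contraction_zero_pure hf₁ hf₂ hg₁ hg₂

/-- Cut g₁ = c₁ ⊗ d₁ after its first `m` letters and g₂ = c₂ ⊗ d₂ before its last `m`. Both sides
then equal ⟨c₁, f₂⟩⟨d₁, c₂⟩⟨f₁, d₂⟩: on the right the outer two factors come from the contractions.
-/
theorem inner_contraction_zero_swap_pure {m n : ℕ} (hmn : m ≤ n) {f₁ f₂ : Particle m}
    {g₁ g₂ : Particle n} (hf₁ : f₁ ∈ realPure m) (hf₂ : f₂ ∈ realPure m) (hg₁ : g₁ ∈ realPure n)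
    (hg₂ : g₂ ∈ realPure n) :
    (inner ℂ (contraction 0 g₁ f₁) (contraction 0 f₂ g₂) : ℂ) =
      inner ℂ (contraction m (adj f₂) g₁) (contraction m g₂ (adj f₁)) := by
  obtain ⟨a₁, ra₁, ha₁, hf₁⟩ := hf₁
  obtain ⟨a₂, ra₂, ha₂, hf₂⟩ := hf₂
  obtain ⟨b₁, rb₁, hb₁, hg₁⟩ := hg₁
  obtain ⟨b₂, rb₂, hb₂, hg₂⟩ := hg₂
  have hr₁ : incl (adj f₁) = incl (purePart a₁.reverse) := by
    rw [← conjJ_incl, hf₁, conjJ_pureTensor ra₁, pureTensor]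
  have hr₂ : incl (adj f₂) = incl (purePart a₂.reverse) := by
    rw [← conjJ_incl, hf₂, conjJ_pureTensor ra₂, pureTensor]
  rw [contraction_congr 0 hb₁.symm ha₁.symm hg₁ hf₁, contraction_congr 0 ha₂.symm hb₂.symm hf₂ hg₂,
    contraction_congr m (by simp [ha₂]) hb₁.symm hr₂ hg₁,
    contraction_congr m hb₂.symm (by simp [ha₁]) hg₂ hr₁,
    contraction_zero_purePart, contraction_zero_purePart]
  obtain ⟨c₁, d₁, rfl, hc₁⟩ := exists_append_length_left (hmn.trans_eq hb₁.symm)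
  obtain ⟨c₂, d₂, rfl, hd₂⟩ := exists_append_length_right (hmn.trans_eq hb₂.symm)
  rw [List.length_append] at hb₁ hb₂
  have hcd : d₁.length = c₂.length := by omega
  rw [contraction_purePart_of_eq (A := []) (B := a₂.reverse) (C := c₁.reverse) (D := d₁)
      (List.nil_append _).symm (by simp) (by simp [ha₂]) (by simp [ha₂, hc₁]) ra₂.reverse,
    contraction_purePart_of_eq (A := c₂) (B := d₂) (C := a₁) (D := [])
      rfl (by simp) hd₂.symm (hd₂.trans ha₁.symm) rb₂.right, inner_smul_left, inner_smul_right,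
    listInner_reverse (ha₂.trans hc₁.symm), conj_listInner, List.append_nil, List.nil_append,
    inner_pureTensor hcd, List.append_assoc,
    inner_pureTensor (by simp only [List.length_append]; omega),
    listInner_append (hc₁.trans ha₂.symm), listInner_append hcd, listInner_comm ra₁ rb₂.right]
  ring

theorem inner_contraction_zero_swap {m n : ℕ} (hmn : m ≤ n) (f₁ f₂ : Particle m)
    (g₁ g₂ : Particle n) :
    (inner ℂ (contraction 0 g₁ f₁) (contraction 0 f₂ g₂) : ℂ) =
      inner ℂ (contraction m (adj f₂) g₁) (contraction m g₂ (adj f₁)) := by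
  simp only [← contractionL_apply, ← adjL_apply]
  induction f₁ using realPure_induction with
  | hadd f f' hf hf' => simp only [map_add, inner_add_left, inner_add_right, hf, hf']
  | hsmul c f hf =>
    simp only [map_smul, ContinuousLinearMap.map_smulₛₗ, inner_smul_left, inner_smul_right, hf]
  | hclosed => exact isClosed_eq (by fun_prop) (by fun_prop)
  | hpure f₁ hf₁ =>
  induction f₂ using realPure_induction with
  | hadd f f' hf hf' => simp only [map_add, add_apply, inner_add_left, inner_add_right, hf, hf']
  | hsmul c f hf =>
    simp only [map_smul, ContinuousLinearMap.map_smulₛₗ, smul_apply, inner_smul_left,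
      inner_smul_right, hf, Complex.conj_conj]
  | hclosed => exact isClosed_eq (by fun_prop) (by fun_prop)
  | hpure f₂ hf₂ =>
  induction g₁ using realPure_induction with
  | hadd f f' hf hf' => simp only [map_add, add_apply, inner_add_left, hf, hf']
  | hsmul c f hf => simp only [map_smul, smul_apply, inner_smul_left, hf]
  | hclosed => exact isClosed_eq (by fun_prop) (by fun_prop)
  | hpure g₁ hg₁ =>
  induction g₂ using realPure_induction with
  | hadd f f' hf hf' => simp only [map_add, add_apply, inner_add_right, hf, hf']
  | hsmul c f hf => simp only [map_smul, smul_apply, inner_smul_right, hf]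
  | hclosed => exact isClosed_eq (by fun_prop) (by fun_prop)
  | hpure g₂ hg₂ => exact inner_contraction_zero_swap_pure hmn hf₁ hf₂ hg₁ hg₂

/-! ### Moments of Wigner integrals -/

theorem inner_contraction_of_ne {m n m' n' p q : ℕ} (f : Particle m) (g : Particle n)
    (f' : Particle m') (g' : Particle n') (h : m + n + 2 * q ≠ m' + n' + 2 * p) :
    (inner ℂ (contraction p f g) (contraction q f' g') : ℂ) = 0 := by
  by_cases hp : p ≤ m ∧ p ≤ n
  · obtain ⟨⟨a, rfl⟩, ⟨b, rfl⟩⟩ := And.imp Nat.exists_eq_add_of_le' Nat.exists_eq_add_of_le hp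
    rw [contraction_eq_incl, inner_incl_left, contraction_apply_ne _ _ (by omega),
      inner_zero_right]
  · rw [contraction_of_not_le hp, inner_zero_left]

theorem wignerL_incl_min {m n : ℕ} (f : Particle m) (g : Particle n) :
    wignerL m f (incl g) = ∑ p ∈ Finset.range (min m n + 1), contraction p f g := by
  rw [wignerL_incl]
  refine (Finset.sum_subset (fun p hp => ?_) fun p _ hp => ?_).symm
  · rw [Finset.mem_range] at hp ⊢
    omega
  · rw [Finset.mem_range] at hp
    exact contraction_of_not_le (by omega) _ _

/-- Equal total degrees make contractions of different orders orthogonal, so only the diagonal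
survives. -/
theorem inner_sum_contraction {m n m' n' : ℕ} (f : Particle m) (g : Particle n)
    (f' : Particle m') (g' : Particle n') (h : m + n = m' + n') (k : ℕ) :
    (inner ℂ (∑ p ∈ Finset.range k, contraction p f g)
      (∑ p ∈ Finset.range k, contraction p f' g') : ℂ) =
      ∑ p ∈ Finset.range k, inner ℂ (contraction p f g) (contraction p f' g') := by
  rw [sum_inner]
  refine Finset.sum_congr rfl fun p hp => ?_
  rw [inner_sum, Finset.sum_eq_single_of_mem p hp]
  intro q _ hq
  exact inner_contraction_of_ne _ _ _ _ (by omega)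

/-- Each contraction lowers the total degree by an even number, so the two vectors live in degrees
of opposite parity. -/
theorem inner_wignerL_incl_of_parity {m n m' n' : ℕ} (f : Particle m) (g : Particle n)
    (f' : Particle m') (g' : Particle n') (h : (m + n) % 2 ≠ (m' + n') % 2) :
    (inner ℂ (wignerL m f (incl g)) (wignerL m' f' (incl g')) : ℂ) = 0 := by
  rw [wignerL_incl, wignerL_incl, sum_inner]
  refine Finset.sum_eq_zero fun p _ => ?_
  rw [inner_sum]
  exact Finset.sum_eq_zero fun q _ => inner_contraction_of_ne _ _ _ _ (by omega)

theorem trace_mul_four {A B : Fock →L[ℂ] Fock} (C D : Fock →L[ℂ] Fock) (hA : star A = A)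
    (hB : star B = B) :
    trace (A * B * C * D) = inner ℂ (B (A vacuum)) (C (D vacuum)) := by
  rw [mul_assoc (A * B), trace_mul, star_mul, hA, hB, mul_apply_eq_comp, mul_apply_eq_comp]

section SelfAdjoint

variable {m n : ℕ} {f : Particle m} {g : Particle n}

theorem star_wignerL_of_adj_eq (hf : adj f = f) : star (wignerL m f) = wignerL m f := by
  rw [star_wignerL, hf]

theorem trace_wignerL (hm : 1 ≤ m) (f : Particle m) : trace (wignerL m f) = 0 := by
  rw [trace, wignerL_vacuum, vacuum, inner_incl_of_ne (by omega)]

theorem trace_wignerL_mul (hf : adj f = f) (g : Particle n) :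
    trace (wignerL m f * wignerL n g) = inner ℂ (incl f) (incl g) := by
  rw [trace_mul, star_wignerL_of_adj_eq hf, wignerL_vacuum, wignerL_vacuum]

theorem trace_wignerL_sq (hf : adj f = f) : trace (wignerL m f ^ 2) = ((‖f‖ ^ 2 : ℝ) : ℂ) := by
  rw [sq, trace_wignerL_mul hf, inner_incl_incl, inner_self_eq_norm_sq_to_K]
  norm_cast

theorem norm_contraction_zero (f : Particle m) (g : Particle n) :
    ‖contraction 0 f g‖ ^ 2 = ‖f‖ ^ 2 * ‖g‖ ^ 2 := by
  have h := inner_contraction_zero f f g g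
  rw [inner_self_eq_norm_sq_to_K, inner_self_eq_norm_sq_to_K, inner_self_eq_norm_sq_to_K] at h
  exact_mod_cast h

theorem norm_contraction_self (hf : adj f = f) : ‖contraction m f f‖ ^ 2 = ‖f‖ ^ 2 * ‖f‖ ^ 2 := by
  have hv : ‖vacuum‖ = 1 := by
    rw [norm_eq_sqrt_re_inner (𝕜 := ℂ), inner_vacuum_vacuum]
    simp
  rw [contraction_self, conjJ_incl, hf, inner_incl_incl, norm_smul, hv, mul_one,
    inner_self_eq_norm_sq_to_K]
  simp
  ring

theorem norm_contraction_comm (hf : adj f = f) (hg : adj g = g) (p : ℕ) :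
    ‖contraction p g f‖ = ‖contraction p f g‖ := by
  have h := conjJ_contraction p f g
  rw [hf, hg] at h
  rw [← h, norm_eq_sqrt_re_inner (𝕜 := ℂ), inner_conjJ_conjJ, ← norm_eq_sqrt_re_inner]

theorem inner_wignerL_self (f : Particle m) (g : Particle n) :
    (inner ℂ (wignerL m f (incl g)) (wignerL m f (incl g)) : ℂ) =
      ((∑ p ∈ Finset.range (min m n + 1), ‖contraction p f g‖ ^ 2 : ℝ) : ℂ) := by
  rw [wignerL_incl_min, inner_sum_contraction _ _ _ _ rfl, Complex.ofReal_sum]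
  refine Finset.sum_congr rfl fun p _ => ?_
  rw [inner_self_eq_norm_sq_to_K]
  norm_cast

theorem sum_range_succ_eq_sum_Icc (a : ℕ → ℝ) (k : ℕ) :
    ∑ p ∈ Finset.range (k + 1), a p = a 0 + ∑ p ∈ Finset.Icc 1 k, a p := by
  rw [Finset.range_eq_Ico, Finset.sum_eq_sum_Ico_succ_bot (Nat.succ_pos k)]
  rfl

theorem sum_Icc_eq_sum_Ico (a : ℕ → ℝ) {k : ℕ} (hk : 1 ≤ k) :
    ∑ p ∈ Finset.Icc 1 k, a p = ∑ p ∈ Finset.Ico 1 k, a p + a k :=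
  Finset.sum_Ico_succ_top hk a

/-- The fourth free cumulant of a self-adjoint Wigner integral. -/
theorem kappa4_wignerL (hm : 1 ≤ m) (hf : adj f = f) :
    kappa4 (wignerL m f) = ((∑ p ∈ Finset.Ico 1 m, ‖contraction p f f‖ ^ 2 : ℝ) : ℂ) := by
  have hs := star_wignerL_of_adj_eq hf
  have e : wignerL m f ^ 4 = wignerL m f * wignerL m f * wignerL m f * wignerL m f := by
    rw [pow_succ, pow_succ, sq]
  -- The extreme orders 0 and `m` each contribute ‖f‖⁴, together exactly the subtracted 2τ₀(X²)².
  rw [kappa4_of_centered (trace_wignerL hm f), trace_wignerL_sq hf, e, trace_mul_four _ _ hs hs,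
    wignerL_vacuum, inner_wignerL_self, min_self, sum_range_succ_eq_sum_Icc,
    sum_Icc_eq_sum_Ico _ hm, norm_contraction_zero, norm_contraction_self hf]
  push_cast
  ring

theorem trace_sq_mul_sq_cyclic (f : Particle m) (g : Particle n) :
    trace (wignerL m f * wignerL m f * wignerL n g * wignerL n g) =
      trace (wignerL m f * wignerL n g * wignerL n g * wignerL m f) := by
  have hX := wignerL_mem f
  have hY := wignerL_mem g
  rw [show wignerL m f * wignerL m f * wignerL n g * wignerL n g =
    wignerL m f * (wignerL m f * wignerL n g * wignerL n g) by simp only [mul_assoc],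
    trace_mul_comm hX (mul_mem_vonNeumann (mul_mem_vonNeumann hX hY) hY)]

theorem trace_sq_mul_sq_comm (f : Particle m) (g : Particle n) :
    trace (wignerL m f * wignerL m f * wignerL n g * wignerL n g) =
      trace (wignerL n g * wignerL n g * wignerL m f * wignerL m f) := by
  have hX := wignerL_mem f
  have hY := wignerL_mem g
  rw [mul_assoc (wignerL m f * wignerL m f),
    trace_mul_comm (mul_mem_vonNeumann hX hX) (mul_mem_vonNeumann hY hY), ← mul_assoc]

theorem trace_alternating_comm (f : Particle m) (g : Particle n) :
    trace (wignerL m f * wignerL n g * wignerL m f * wignerL n g) =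
      trace (wignerL n g * wignerL m f * wignerL n g * wignerL m f) := by
  have hX := wignerL_mem f
  have hY := wignerL_mem g
  rw [trace_mul_comm (mul_mem_vonNeumann (mul_mem_vonNeumann hX hY) hX) hY]
  simp only [mul_assoc]

/-- The polarization identity for the fourth free cumulant. -/
theorem kappa4_wignerL_add (hf : adj f = f) (hg : adj g = g) (hm : 1 ≤ m) (hn : 1 ≤ n)
    (hmn : m % 2 ≠ n % 2) :
    kappa4 (wignerL m f + wignerL n g) = kappa4 (wignerL m f) + kappa4 (wignerL n g) +
      (4 * cov (wignerL m f ^ 2) (wignerL n g ^ 2) +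
        2 * trace (wignerL m f * wignerL n g * wignerL m f * wignerL n g)) := by
  have hX := star_wignerL_of_adj_eq hf
  have hY := star_wignerL_of_adj_eq hg
  have e4 : ∀ A : Fock →L[ℂ] Fock, A ^ 4 = A * A * A * A := fun A => by
    rw [pow_succ, pow_succ, sq]
  have add_trace : ∀ A B : Fock →L[ℂ] Fock, trace (A + B) = trace A + trace B := fun A B => by
    rw [trace, add_apply, inner_add_right, trace, trace]
  have h0 : trace (wignerL m f + wignerL n g) = 0 := by
    rw [add_trace, trace_wignerL hm, trace_wignerL hn, add_zero]
  have hXY : trace (wignerL m f * wignerL n g) = 0 := by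
    rw [trace_wignerL_mul hf, inner_incl_of_ne (by omega)]
  have hYX : trace (wignerL n g * wignerL m f) = 0 := by
    rw [trace_wignerL_mul hg, inner_incl_of_ne (by omega)]
  have h2 : trace ((wignerL m f + wignerL n g) ^ 2) =
      trace (wignerL m f ^ 2) + trace (wignerL n g ^ 2) := by
    simp only [sq, add_mul, mul_add, add_trace, hXY, hYX]
    ring
  have hS : star (wignerL m f + wignerL n g) = wignerL m f + wignerL n g := by
    rw [star_add, hX, hY]
  have hAD := trace_sq_mul_sq_comm f g
  have hCC := trace_sq_mul_sq_cyclic f g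
  have hBB := trace_sq_mul_sq_cyclic g f
  have hBC := trace_alternating_comm f g
  have hcov : trace (wignerL m f ^ 2 * wignerL n g ^ 2) =
      trace (wignerL m f * wignerL m f * wignerL n g * wignerL n g) := by
    rw [sq, sq, ← mul_assoc]
  have h4 : trace ((wignerL m f + wignerL n g) ^ 4) =
      trace (wignerL m f ^ 4) + trace (wignerL n g ^ 4) +
        4 * trace (wignerL m f * wignerL m f * wignerL n g * wignerL n g) +
        2 * trace (wignerL m f * wignerL n g * wignerL m f * wignerL n g) := by
    rw [trace_mul_four _ _ hX hX, trace_mul_four _ _ hY hY] at hAD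
    rw [trace_mul_four _ _ hX hX, trace_mul_four _ _ hX hY] at hCC
    rw [trace_mul_four _ _ hY hY, trace_mul_four _ _ hY hX] at hBB
    rw [trace_mul_four _ _ hX hY, trace_mul_four _ _ hY hX] at hBC
    rw [e4, e4, e4, trace_mul_four _ _ hS hS, trace_mul_four _ _ hX hX, trace_mul_four _ _ hY hY,
      trace_mul_four _ _ hX hX, trace_mul_four _ _ hX hY]
    simp only [wignerL_vacuum] at hAD hCC hBB hBC
    simp only [add_apply, map_add, wignerL_vacuum, inner_add_left, inner_add_right]
    -- These are the eight words in which one letter occurs three times; they pair a vector of even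
    -- degrees with one of odd degrees.
    have o1 := inner_wignerL_incl_of_parity f f f g (by omega)
    have o2 := inner_wignerL_incl_of_parity f f g f (by omega)
    have o3 := inner_wignerL_incl_of_parity g g f g (by omega)
    have o4 := inner_wignerL_incl_of_parity g g g f (by omega)
    have o5 := inner_wignerL_incl_of_parity f g f f (by omega)
    have o6 := inner_wignerL_incl_of_parity g f f f (by omega)
    have o7 := inner_wignerL_incl_of_parity f g g g (by omega)
    have o8 := inner_wignerL_incl_of_parity g f g g (by omega)
    rw [o1, o2, o3, o4, o5, o6, o7, o8]
    -- `hAD` counts twice: once for YYXX, and once because YXXY is reduced to XXYY through YYXX.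
    linear_combination -2 * hAD - hCC - hBB - hBC
  rw [kappa4_of_centered h0, kappa4_of_centered (trace_wignerL hm f),
    kappa4_of_centered (trace_wignerL hn g), h4, h2, cov, hcov]
  ring

/-- The swap identity requires the smaller degree first, hence the two cases; it returns the
arguments of the inner product possibly exchanged, which the real part ignores. -/
theorem re_inner_contraction_zero_eq (hf : adj f = f) (hg : adj g = g) :
    (inner ℂ (contraction 0 g f) (contraction 0 f g) : ℂ).re =
      (inner ℂ (contraction (min m n) g f) (contraction (min m n) f g) : ℂ).re := by
  rcases le_total m n with h | h
  · rw [min_eq_left h, inner_contraction_zero_swap h, hf]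
    exact inner_re_symm (𝕜 := ℂ) _ _
  · have e := inner_contraction_zero_swap h g g f f
    rw [hg] at e
    rw [min_eq_right h, ← e]
    exact inner_re_symm (𝕜 := ℂ) _ _

/-- The mixed part of the fourth free cumulant of a sum of two Wigner integrals, as a sum of squared
norms of contractions. -/
theorem mixed_cumulant_eq (hf : adj f = f) (hg : adj g = g) (hm : 1 ≤ m) (hn : 1 ≤ n) :
    4 * cov (wignerL m f ^ 2) (wignerL n g ^ 2) +
        2 * trace (wignerL m f * wignerL n g * wignerL m f * wignerL n g) =
      ((2 * ∑ p ∈ Finset.Ico 1 (min m n), ‖contraction p f g‖ ^ 2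
        + ∑ p ∈ Finset.Icc 1 (min m n), ‖contraction p f g + contraction p g f‖ ^ 2
        + ‖contraction (min m n) f g + contraction (min m n) g f‖ ^ 2 : ℝ) : ℂ) := by
  have hX := star_wignerL_of_adj_eq hf
  have hY := star_wignerL_of_adj_eq hg
  have hk : 1 ≤ min m n := le_min hm hn
  have hcov : trace (wignerL m f ^ 2 * wignerL n g ^ 2) =
      ((∑ p ∈ Finset.range (min m n + 1), ‖contraction p f g‖ ^ 2 : ℝ) : ℂ) := by
    rw [sq, sq, ← mul_assoc, trace_sq_mul_sq_cyclic, trace_mul_four _ _ hX hY, wignerL_vacuum,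
      inner_wignerL_self, min_comm n m]
    simp only [norm_contraction_comm hf hg]
  have hsum : trace (wignerL m f * wignerL n g * wignerL m f * wignerL n g) =
      ∑ p ∈ Finset.range (min m n + 1), inner ℂ (contraction p g f) (contraction p f g) := by
    rw [trace_mul_four _ _ hX hY, wignerL_vacuum, wignerL_vacuum, wignerL_incl_min,
      wignerL_incl_min, min_comm n m, inner_sum_contraction _ _ _ _ (add_comm n m)]
  -- Conjugation turns τ₀(XYXY) into τ₀(YXYX), which is the same number by traciality; this permits
  -- taking real parts termwise.
  have hreal : (starRingEnd ℂ) (trace (wignerL m f * wignerL n g * wignerL m f * wignerL n g)) =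
      trace (wignerL m f * wignerL n g * wignerL m f * wignerL n g) := by
    conv_rhs => rw [trace_alternating_comm]
    rw [trace_mul_four _ _ hX hY, trace_mul_four _ _ hY hX, inner_conj_symm]
  have htr : trace (wignerL m f * wignerL n g * wignerL m f * wignerL n g) =
      ((∑ p ∈ Finset.range (min m n + 1),
        (inner ℂ (contraction p g f) (contraction p f g) : ℂ).re : ℝ) : ℂ) := by
    rw [← Complex.conj_eq_iff_re.1 hreal, hsum, Complex.re_sum]
  have hnorm : ∀ p, ‖contraction p f g + contraction p g f‖ ^ 2 = 2 * ‖contraction p f g‖ ^ 2 +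
      2 * (inner ℂ (contraction p g f) (contraction p f g) : ℂ).re := fun p => by
    rw [norm_add_sq (𝕜 := ℂ), norm_contraction_comm hf hg, inner_re_symm]
    change _ + 2 * (inner ℂ (contraction p g f) (contraction p f g) : ℂ).re + _ = _
    ring
  have h0 := re_inner_contraction_zero_eq hf hg
  simp only [hnorm, Finset.sum_add_distrib, ← Finset.mul_sum]
  rw [cov, hcov, htr, trace_wignerL_sq hf, trace_wignerL_sq hg]
  norm_cast
  -- The product ‖f‖²‖g‖² is the p = 0 term of τ₀(X²Y²) and cancels. By `h0` the p = 0 term of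
  -- τ₀(XYXY) becomes a second copy of the top one, which with the remaining 2‖f ⌢ᵖ g‖² at p = m ∧ n
  -- forms the last square.
  rw [← norm_contraction_zero, sum_range_succ_eq_sum_Icc, sum_range_succ_eq_sum_Icc, h0,
    sum_Icc_eq_sum_Ico _ hk, sum_Icc_eq_sum_Ico _ hk]
  ring

end SelfAdjoint

end FreeWigner

end
theorem mainTheorem3 (m n : ℕ) (hm : 1 ≤ m) (hn : 1 ≤ n) (hmn : m % 2 ≠ n % 2)
    (f : FreeWigner.Particle m) (g : FreeWigner.Particle n)
    (hf : FreeWigner.adj f = f) (hg : FreeWigner.adj g = g)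
    (X Y : FreeWigner.Fock →L[ℂ] FreeWigner.Fock)
    (hX : X = FreeWigner.wignerIntegral f) (hY : Y = FreeWigner.wignerIntegral g) :
    -- `I₀(f)` and `I₀(g)` are well defined
    (∃! A, FreeWigner.IsWignerIntegral f A) ∧ (∃! B, FreeWigner.IsWignerIntegral g B) ∧
    -- the polarization identity
    FreeWigner.kappa4 (X + Y) = FreeWigner.kappa4 X + FreeWigner.kappa4 Y
      + (4 * FreeWigner.cov (X ^ 2) (Y ^ 2) + 2 * FreeWigner.trace (X * Y * X * Y)) ∧
    -- nonnegativity (of complex numbers: real and nonnegative)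
    0 ≤ FreeWigner.kappa4 X ∧ 0 ≤ FreeWigner.kappa4 Y ∧
    0 ≤ 4 * FreeWigner.cov (X ^ 2) (Y ^ 2) + 2 * FreeWigner.trace (X * Y * X * Y) ∧
    -- the expressions as sums of squared norms of contractions
    FreeWigner.kappa4 X =
      ((∑ p ∈ Finset.Ico 1 m, ‖FreeWigner.contraction p f f‖ ^ 2 : ℝ) : ℂ) ∧
    FreeWigner.kappa4 Y =
      ((∑ p ∈ Finset.Ico 1 n, ‖FreeWigner.contraction p g g‖ ^ 2 : ℝ) : ℂ) ∧
    4 * FreeWigner.cov (X ^ 2) (Y ^ 2) + 2 * FreeWigner.trace (X * Y * X * Y) =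
      ((2 * ∑ p ∈ Finset.Ico 1 (min m n), ‖FreeWigner.contraction p f g‖ ^ 2
        + ∑ p ∈ Finset.Icc 1 (min m n),
            ‖FreeWigner.contraction p f g + FreeWigner.contraction p g f‖ ^ 2
        + ‖FreeWigner.contraction (min m n) f g + FreeWigner.contraction (min m n) g f‖ ^ 2 : ℝ)
        : ℂ) := by
  subst hX hY
  rw [FreeWigner.wignerIntegral_eq, FreeWigner.wignerIntegral_eq]
  have h1 := FreeWigner.kappa4_wignerL hm hf
  have h2 := FreeWigner.kappa4_wignerL hn hg
  have h3 := FreeWigner.mixed_cumulant_eq hf hg hm hn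
  refine ⟨FreeWigner.existsUnique_isWignerIntegral f, FreeWigner.existsUnique_isWignerIntegral g,
    FreeWigner.kappa4_wignerL_add hf hg hm hn hmn, ?_, ?_, ?_, h1, h2, h3⟩
  · rw [h1, Complex.zero_le_real]
    positivity
  · rw [h2, Complex.zero_le_real]
    positivity
  · rw [h3, Complex.zero_le_real]
    positivity
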